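/- Let $\mathcal L=\mathcal L_1\cup\mathcal L_2\cup\mathcal L_3\cup\mathcal L_4$ be a set of lines in $\mathbb R^3$ of four colors, each color class $\mathcal L_i$ consisting of exactly $3$ lines. Assume that * $\mathcal L$ is $3$-consistent: for every set $S$ of three colors, every line $\ell$ with a color in $S$ contains a point through which pass lines of all three colors in $S$; * $\mathcal L$ has no colorful incidence: no point lies on lines of all four colors; * $\mathcal L$ is not contained in a $2$-plane. Then, up to a permutation of the colors, $\mathcal L$ is one of the following. (D) *A colored Desargues-type configuration.* There are six distinct planes $\Pi_1,\dots,\Pi_6$ in $\mathbb R^3$ such that each of the families $\{\Pi_1,\dots,\Pi_5\}$ and $\{\Pi_1,\Pi_2,\Pi_3,\Pi_6\}$ is in general position (in the projective sense: any two planes of the family meet in a line, any three in a single point, which may be at infinity, and no four have a common point, even at infinity), the planes $\Pi_4,\Pi_5,\Pi_6$ intersect in a line, $\mathcal L$ is the set of all lines that are contained in exactly two of the six planes, and the color classes are $$\{\Pi_i\cap\Pi_{i'} : 1\le i<i'\le 3\}\quad\text{and}\quad \{\Pi_i\cap\Pi_{3+j} : 1\le i,j\le 3,\ j-i\equiv k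 \pmod 3\}\quad (k=0,1,2).$$ (R) *A colored Reye-type configuration.* Some projective transformation of real projective $3$-space carries $\mathcal L$ to $12$ of the $16$ lines that support the $12$ edges and the $4$ long diagonals of the cube $[0,1]^3$, and these $12$ lines form a $(12_3)$ configuration: there are $12$ points of projective space such that each of the points is on exactly $3$ of the lines and each of the lines contains exactly $3$ of the points. Moreover, denoting by $xyz$ the vertex $(x,y,z)$ of the cube and by $u\text{–}v$ the line through the vertices $u$ and $v$, the transformation can be chosen so that the color classes are carried to $$\begin{aligned}&\{001\text{–}101,\ 100\text{–}110,\ 010\text{–}011\},\qquad &&\{000\text{–}010,\ 011\text{–}111,\ 110\text{–}001\},\\ &\{110\text{–}111,\ 000\text{–}100,\ 010\text{–}101\},\qquad &&\{101\text{–}111,\ 000\text{–}001,\ 011\text{–}100\}.\end{aligned}$$ -/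

import Mathlib

noncomputable section

/-- Real 3-space. Only its affine structure is used. -/
abbrev Space : Type := Fin 3 → ℝ

/-- An affine subspace is a line if its direction is one-dimensional (the empty subspace has a
zero-dimensional direction, so it is not a line). -/
def IsLine (l : AffineSubspace ℝ Space) : Prop :=
  Module.finrank ℝ l.direction = 1

/-- An affine subspace is a plane if its direction is two-dimensional. -/
def IsPlane (P : AffineSubspace ℝ Space) : Prop :=
  Module.finrank ℝ P.direction = 2

/-! ### Colored sets of lines -/

/-- The point `p` carries an `S`-incidence of the colored set of lines `L` (`L i` is the color
class of color `i`): lines of every color in `S` pass through `p`. -/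
def IsIncidenceAt {ι : Type*} (L : ι → Set (AffineSubspace ℝ Space)) (S : Finset ι)
    (p : Space) : Prop :=
  ∀ i ∈ S, ∃ l ∈ L i, p ∈ l

/-- `k`-consistency: for every set `S` of `k` colors, every line with a color in `S` belongs to
an `S`-incidence. -/
def IsConsistent {ι : Type*} (k : ℕ) (L : ι → Set (AffineSubspace ℝ Space)) : Prop :=
  ∀ S : Finset ι, S.card = k → ∀ i ∈ S, ∀ l ∈ L i, ∃ p ∈ l, IsIncidenceAt L S p

/-- There is a colorful incidence: lines of all colors pass through a common point. -/
def HasColorfulIncidence {ι : Type*} [Fintype ι] (L : ι → Set (AffineSubspace ℝ Space)) : Prop :=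
  ∃ p : Space, IsIncidenceAt L Finset.univ p

/-! ### Projective completion

Real projective 3-space is the set of lines through the origin of `Space × ℝ`; the affine point
`x` is the line spanned by `(x, 1)`, and projective lines and planes are linear subspaces of
dimensions 2 and 3. -/

/-- Homogeneous coordinates. -/
abbrev HomSpace : Type := Space × ℝ

/-- The projective completion of an affine subspace, as a linear subspace of `HomSpace`. -/
def projCompletion (l : AffineSubspace ℝ Space) : Submodule ℝ HomSpace :=
  Submodule.span ℝ ((fun x : Space => ((x, 1) : HomSpace)) '' (l : Set Space))

/-- The image of (the projective completion of) an affine subspace under the projective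
transformation induced by the linear automorphism `T`. -/
def projImage (T : HomSpace ≃ₗ[ℝ] HomSpace) (l : AffineSubspace ℝ Space) :
    Submodule ℝ HomSpace :=
  (projCompletion l).map (T : HomSpace →ₗ[ℝ] HomSpace)

/-! ### Reye-type configurations -/

/-- A set `M` of lines of projective 3-space is (the set of lines of) a `(12_3)` configuration:
it has 12 lines, and for some set of 12 points, every point is on exactly 3 of the lines and
every line contains exactly 3 of the points. -/
def IsTwelveThree (M : Set (Submodule ℝ HomSpace)) : Prop :=
  M.ncard = 12 ∧
  ∃ P : Set (Submodule ℝ HomSpace),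
    P.ncard = 12 ∧
    (∀ p ∈ P, Module.finrank ℝ p = 1 ∧ {l ∈ M | p ≤ l}.ncard = 3) ∧
    (∀ l ∈ M, {p ∈ P | p ≤ l}.ncard = 3)

/-- The 16 lines supporting the 12 edges and the 4 long diagonals of the unit cube: the lines
through two vertices that differ in exactly one coordinate, or in all three. -/
def cubeLines : Set (AffineSubspace ℝ Space) :=
  {l | ∃ v w : Space, (∀ i, v i = 0 ∨ v i = 1) ∧ (∀ i, w i = 0 ∨ w i = 1) ∧
    ((∃! i, v i ≠ w i) ∨ (∀ i, v i ≠ w i)) ∧ l = line[ℝ, v, w]}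

/-- A coloring of 12 of the 16 cube lines. The 4 cube lines left out are the diagonal
from `000` to `111` and the edges `010`-`110`, `001`-`011`, `100`-`101`. -/
def reyeColoring : Fin 4 → Set (AffineSubspace ℝ Space) :=
  ![{line[ℝ, ![0, 0, 1], ![1, 0, 1]], line[ℝ, ![1, 0, 0], ![1, 1, 0]],
      line[ℝ, ![0, 1, 0], ![0, 1, 1]]},
    {line[ℝ, ![0, 0, 0], ![0, 1, 0]], line[ℝ, ![0, 1, 1], ![1, 1, 1]],
      line[ℝ, ![1, 1, 0], ![0, 0, 1]]},
    {line[ℝ, ![1, 1, 0], ![1, 1, 1]], line[ℝ, ![0, 0, 0], ![1, 0, 0]],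
      line[ℝ, ![0, 1, 0], ![1, 0, 1]]},
    {line[ℝ, ![1, 0, 1], ![1, 1, 1]], line[ℝ, ![0, 0, 0], ![0, 0, 1]],
      line[ℝ, ![0, 1, 1], ![1, 0, 0]]}]

/-- `M` is a Reye-type configuration, witnessed by the projective transformation `T`:
`T` carries `M` to 12 of the 16 cube lines, which form a `(12_3)` configuration. -/
def IsReyeTypeVia (T : HomSpace ≃ₗ[ℝ] HomSpace) (M : Set (AffineSubspace ℝ Space)) : Prop :=
  ∃ S ⊆ cubeLines, IsTwelveThree (projCompletion '' S) ∧
    projImage T '' M = projCompletion '' S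

/-- The 4-colored set of lines `L` is a Reye-type configuration with the prescribed coloring, up
to a projective transformation and a permutation of the colors. -/
def IsColoredReyeType (L : Fin 4 → Set (AffineSubspace ℝ Space)) : Prop :=
  ∃ T : HomSpace ≃ₗ[ℝ] HomSpace,
    IsReyeTypeVia T (⋃ i, L i) ∧
    ∃ σ : Equiv.Perm (Fin 4), ∀ i, projImage T '' L (σ i) = projCompletion '' reyeColoring i

/-! ### Desargues-type configurations -/

/-- The planes `Pl i`, `i ∈ s`, are in general position (in projective 3-space): any
`k ≤ 4` of them meet in a subspace of codimension `k`, that is, any two meet in a line, any three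
in a single point, possibly at infinity, and no four have a common point. -/
def InGeneralPosition (Pl : Fin 6 → AffineSubspace ℝ Space) (s : Finset (Fin 6)) : Prop :=
  ∀ t ⊆ s, t.card ≤ 4 →
    Module.finrank ℝ (t.inf fun i => projCompletion (Pl i) : Submodule ℝ HomSpace) + t.card = 4

/-- The set `M` of lines is a Desargues-type configuration, defined by the six planes `Pl`. -/
def IsDesarguesTypeVia (Pl : Fin 6 → AffineSubspace ℝ Space)
    (M : Set (AffineSubspace ℝ Space)) : Prop :=
  (∀ i, IsPlane (Pl i)) ∧ Function.Injective Pl ∧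
  InGeneralPosition Pl {0, 1, 2, 3, 4} ∧ InGeneralPosition Pl {0, 1, 2, 5} ∧
  IsLine (Pl 3 ⊓ Pl 4 ⊓ Pl 5) ∧
  M = {l | IsLine l ∧ {i | l ≤ Pl i}.ncard = 2}

/-- The coloring of a Desargues-type configuration: one color for the three lines in two of
the first three planes; the lines `Pl i ⊓ Pl (3 + j)` with `i, j ∈ {0, 1, 2}` are colored
by `j - i` modulo 3. -/
def desarguesColoring (Pl : Fin 6 → AffineSubspace ℝ Space) :
    Fin 4 → Set (AffineSubspace ℝ Space) :=
  ![{Pl 0 ⊓ Pl 1, Pl 0 ⊓ Pl 2, Pl 1 ⊓ Pl 2},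
    {Pl 0 ⊓ Pl 3, Pl 1 ⊓ Pl 4, Pl 2 ⊓ Pl 5},
    {Pl 0 ⊓ Pl 4, Pl 1 ⊓ Pl 5, Pl 2 ⊓ Pl 3},
    {Pl 0 ⊓ Pl 5, Pl 1 ⊓ Pl 3, Pl 2 ⊓ Pl 4}]

/-- The 4-colored set of lines `L` is a Desargues-type configuration with the prescribed
coloring, up to a permutation of the colors. -/
def IsColoredDesarguesType (L : Fin 4 → Set (AffineSubspace ℝ Space)) : Prop :=
  ∃ Pl : Fin 6 → AffineSubspace ℝ Space,
    IsDesarguesTypeVia Pl (⋃ i, L i) ∧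
    ∃ σ : Equiv.Perm (Fin 4), ∀ i, L (σ i) = desarguesColoring Pl i

end

/-! ### Lines and planes in space -/

section Incidence

variable {l m P Q : AffineSubspace ℝ Space} {p q : Space}

/-! Call a common point of lines of three colors an incidence of these colors. Two incidences of
different color triples never coincide, since all four colors would meet there.

The crux is that incidences are rigid: a line carries only one incidence of any three given colors
including its own, and only one line of each of the three colors passes through an incidence
(`false_of_two_points` and `false_of_two_lines`; for arbitrary colors `point_unique` and
`line_unique`). A violation pushes many lines into one plane, whereas no color class is coplanar
(`exists_not_le`). Lines leaving the plane meet it at most once, and there are so few of them that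
two incidences of different triples end up on the same two lines, hence at the same point.

So every triple of colors matches its three classes bijectively (`exists_matching`). Two of these
matchings never share a pair of lines, and a permutation of three elements without fixed points is a
translation of the integers modulo 3. All incidences are thereby encoded by four shifts
(`exists_cyclicLabelling`), and up to recoloring only three quadruples of shifts survive
(`hasType`).

The shifts `1, 1, 1, 0` force the lines of one color into a plane (`not_hasType`). For `2, 1, 2, 0`
the incidences produce the planes of a Desargues-type configuration: lines that meet pairwise span
them, and the noncoplanarity of the color classes gives general position
(`exists_isDesarguesLabelling`, `IsDesarguesLabelling.isColoredDesarguesType`). For `2, 1, 1, 1`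
there are three noncoplanar lines through one point; this point and one further point on each of
them serve as the origin and the points at infinity of a projective frame. The remaining incidences
determine the other points of the frame as vertices of the cube (`exists_isReyeLabelling`,
`exists_frame`). -/

theorem IsLine.eq_line (hl : IsLine l) (hp : p ∈ l) (hq : q ∈ l) (hpq : p ≠ q) :
    l = line[ℝ, p, q] := by
  have hle : line[ℝ, p, q] ≤ l := affineSpan_pair_le_of_mem_of_mem hp hq
  have hd := AffineSubspace.direction_le hle
  have hfin : Module.finrank ℝ (line[ℝ, p, q]).direction = 1 := by
    rw [direction_affineSpan, vectorSpan_pair]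
    exact finrank_span_singleton (by simpa [sub_eq_zero] using hpq)
  refine (AffineSubspace.eq_of_direction_eq_of_nonempty_of_le ?_ ⟨p, left_mem_affineSpan_pair ℝ p q⟩
    hle).symm
  exact Submodule.eq_of_le_of_finrank_eq hd (hfin.trans hl.symm)

theorem IsLine.le_of_mem (hl : IsLine l) (hpq : p ≠ q) (hp : p ∈ l) (hq : q ∈ l)
    (hp' : p ∈ P) (hq' : q ∈ P) : l ≤ P := by
  rw [hl.eq_line hp hq hpq]
  exact affineSpan_pair_le_of_mem_of_mem hp' hq'

theorem IsLine.eq_point (hl : IsLine l) (hm : IsLine m) (hlm : l ≠ m)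
    (hp : p ∈ l) (hp' : p ∈ m) (hq : q ∈ l) (hq' : q ∈ m) : p = q := by
  by_contra h
  exact hlm ((hl.eq_line hp hq h).trans (hm.eq_line hp' hq' h).symm)

theorem IsLine.nonempty (hl : IsLine l) : (l : Set Space).Nonempty := by
  by_contra h
  rw [Set.not_nonempty_iff_eq_empty, AffineSubspace.coe_eq_bot_iff] at h
  subst h
  unfold IsLine at hl
  rw [AffineSubspace.direction_bot, finrank_bot] at hl
  omega

theorem IsPlane.nonempty (hP : IsPlane P) : (P : Set Space).Nonempty := by
  by_contra h
  rw [Set.not_nonempty_iff_eq_empty, AffineSubspace.coe_eq_bot_iff] at h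
  subst h
  unfold IsPlane at hP
  rw [AffineSubspace.direction_bot, finrank_bot] at hP
  omega

theorem exists_isPlane_of_lines (hl : IsLine l) (hm : IsLine m) (hlm : l ≠ m) (hp : p ∈ l)
    (hp' : p ∈ m) : ∃ P : AffineSubspace ℝ Space, IsPlane P ∧ l ≤ P ∧ m ≤ P := by
  refine ⟨l ⊔ m, ?_, le_sup_left, le_sup_right⟩
  have hd : (l ⊔ m).direction = l.direction ⊔ m.direction := by
    rw [AffineSubspace.direction_sup hp hp']
    simp
  have hsum := Submodule.finrank_sup_add_finrank_inf_eq l.direction m.direction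
  have hinf : Module.finrank ℝ ↥(l.direction ⊓ m.direction) = 0 := by
    by_contra h0
    have h1 : Module.finrank ℝ ↥(l.direction ⊓ m.direction) ≤ 1 :=
      hl ▸ Submodule.finrank_mono inf_le_left
    have h2 : Module.finrank ℝ ↥(l.direction ⊓ m.direction) = 1 := by omega
    have e1 := Submodule.eq_of_le_of_finrank_eq (inf_le_left : l.direction ⊓ m.direction ≤ _)
      (h2.trans hl.symm)
    have e2 := Submodule.eq_of_le_of_finrank_eq (inf_le_right : l.direction ⊓ m.direction ≤ _)
      (h2.trans hm.symm)
    exact hlm (AffineSubspace.ext_of_direction_eq (e1.symm.trans e2) ⟨p, hp, hp'⟩)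
  unfold IsPlane
  rw [hd]
  unfold IsLine at hl hm
  omega

theorem IsPlane.inf_eq (hP : IsPlane P) (hQ : IsPlane Q) (hPQ : P ≠ Q) (hl : IsLine l)
    (hlP : l ≤ P) (hlQ : l ≤ Q) : P ⊓ Q = l := by
  obtain ⟨p, hp⟩ := hl.nonempty
  have hdP := AffineSubspace.direction_le hlP
  have hdir : (P ⊓ Q).direction = P.direction ⊓ Q.direction :=
    AffineSubspace.direction_inf_of_mem (hlP hp) (hlQ hp)
  symm
  refine AffineSubspace.eq_of_direction_eq_of_nonempty_of_le ?_ ⟨p, hp⟩ (le_inf hlP hlQ)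
  refine Submodule.eq_of_le_of_finrank_le (AffineSubspace.direction_le (le_inf hlP hlQ)) ?_
  rw [hdir]
  by_contra h
  unfold IsLine at hl
  unfold IsPlane at hP hQ
  have h1 : Module.finrank ℝ ↥(P.direction ⊓ Q.direction) ≤ 2 :=
    hP ▸ Submodule.finrank_mono inf_le_left
  have h2 : Module.finrank ℝ ↥(P.direction ⊓ Q.direction) = 2 := by omega
  have e1 := Submodule.eq_of_le_of_finrank_eq (inf_le_left : P.direction ⊓ Q.direction ≤ _)
      (h2.trans hP.symm)
  have e2 := Submodule.eq_of_le_of_finrank_eq (inf_le_right : P.direction ⊓ Q.direction ≤ _)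
      (h2.trans hQ.symm)
  exact hPQ (AffineSubspace.ext_of_direction_eq (e1.symm.trans e2) ⟨p, hlP hp, hlQ hp⟩)

end Incidence

/-! ### Consistent four-colored sets of lines -/

/-- The hypotheses of the classification. -/
structure IsAdmissible (L : Fin 4 → Set (AffineSubspace ℝ Space)) : Prop where
  isLine : ∀ i, ∀ l ∈ L i, IsLine l
  consistent : IsConsistent 3 L
  not_colorful : ¬ HasColorfulIncidence L
  card : ∀ i, (L i).ncard = 3
  not_planar : ¬ ∃ P : AffineSubspace ℝ Space, IsPlane P ∧ ∀ i, ∀ l ∈ L i, l ≤ P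

namespace IsAdmissible

variable {L : Fin 4 → Set (AffineSubspace ℝ Space)}

/-- The symmetry that allows each argument to be carried out for one fixed choice of colors. -/
theorem comp_perm (h : IsAdmissible L) (σ : Equiv.Perm (Fin 4)) :
    IsAdmissible (fun i => L (σ i)) where
  isLine i := h.isLine (σ i)
  consistent S hS i hi l hl := by
    obtain ⟨p, hp, hinc⟩ := h.consistent (S.map σ.toEmbedding) (by simpa using hS) (σ i)
      (by simpa using hi) l hl
    exact ⟨p, hp, fun j hj => hinc (σ j) (by simpa using hj)⟩
  not_colorful := by
    rintro ⟨p, hp⟩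
    exact h.not_colorful ⟨p, fun i _ => by simpa using hp (σ.symm i) (Finset.mem_univ _)⟩
  card i := h.card (σ i)
  not_planar := by
    rintro ⟨P, hP, hL⟩
    exact h.not_planar ⟨P, hP, fun i l hl => hL (σ.symm i) l (by simpa using hl)⟩

theorem not_four (h : IsAdmissible L) {p : Space} {a b c d : AffineSubspace ℝ Space}
    (ha : a ∈ L 0) (hb : b ∈ L 1) (hc : c ∈ L 2) (hd : d ∈ L 3)
    (pa : p ∈ a) (pb : p ∈ b) (pc : p ∈ c) (pd : p ∈ d) : False := by
  refine h.not_colorful ⟨p, fun i _ => ?_⟩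
  fin_cases i
  exacts [⟨a, ha, pa⟩, ⟨b, hb, pb⟩, ⟨c, hc, pc⟩, ⟨d, hd, pd⟩]

theorem exists_incidence (h : IsAdmissible L) {i j k : Fin 4} (hij : i ≠ j) (hik : i ≠ k)
    (hjk : j ≠ k) {x : AffineSubspace ℝ Space} (hx : x ∈ L i) :
    ∃ p ∈ x, ∃ y ∈ L j, ∃ z ∈ L k, p ∈ y ∧ p ∈ z := by
  obtain ⟨p, hp, hinc⟩ := h.consistent {i, j, k}
    (Finset.card_eq_three.2 ⟨i, j, k, hij, hik, hjk, rfl⟩) i (by simp) x hx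
  obtain ⟨y, hy, hpy⟩ := hinc j (by simp)
  obtain ⟨z, hz, hpz⟩ := hinc k (by simp)
  exact ⟨p, hp, y, hy, z, hz, hpy, hpz⟩

/-- The incidence of the line `x`, seen with color `i`, and the two colors other than `i` and `j`
would also contain color `j`, through `x` itself. -/
theorem disjoint (h : IsAdmissible L) {i j : Fin 4} (hij : i ≠ j)
    {x y : AffineSubspace ℝ Space} (hx : x ∈ L i) (hy : y ∈ L j) : x ≠ y := by
  rintro rfl
  obtain ⟨k, l, hik, hil, hkl, hall⟩ : ∃ k l : Fin 4, i ≠ k ∧ i ≠ l ∧ k ≠ l ∧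
      ∀ m : Fin 4, m = i ∨ m = j ∨ m = k ∨ m = l := by
    clear hx hy
    revert i j
    decide
  obtain ⟨p, hp, z, hz, w, hw, hpz, hpw⟩ := h.exists_incidence hik hil hkl hx
  refine h.not_colorful ⟨p, fun m _ => ?_⟩
  obtain rfl | rfl | rfl | rfl := hall m
  exacts [⟨x, hx, hp⟩, ⟨x, hy, hp⟩, ⟨z, hz, hpz⟩, ⟨w, hw, hpw⟩]

/-- Lines of different colors have at most one common point. -/
theorem eq_point (h : IsAdmissible L) {i j : Fin 4} (hij : i ≠ j)
    {x y : AffineSubspace ℝ Space} (hx : x ∈ L i) (hy : y ∈ L j) {p q : Space}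
    (px : p ∈ x) (py : p ∈ y) (qx : q ∈ x) (qy : q ∈ y) : p = q :=
  (h.isLine i x hx).eq_point (h.isLine j y hy) (h.disjoint hij hx hy) px py qx qy

/-- No color class is contained in a plane. -/
theorem exists_not_le (h : IsAdmissible L) (i : Fin 4) {P : AffineSubspace ℝ Space}
    (hP : IsPlane P) : ∃ l ∈ L i, ¬ l ≤ P := by
  by_contra! hc
  refine h.not_planar ⟨P, hP, fun j l hl => ?_⟩
  by_cases hij : j = i
  · subst hij
    exact hc l hl
  obtain ⟨k, k', hjk, hjk', hkk', hik, hik', hall⟩ : ∃ k k' : Fin 4, j ≠ k ∧ j ≠ k' ∧ k ≠ k' ∧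
      i ≠ k ∧ i ≠ k' ∧ ∀ m : Fin 4, m = i ∨ m = j ∨ m = k ∨ m = k' := by
    clear hc hl
    revert i j
    decide
  -- Both triples contain the color `i`, so both incidences lie in `P`. They are distinct because
  -- together they involve all four colors.
  obtain ⟨p, hp, y, hy, z, hz, hpy, hpz⟩ := h.exists_incidence hij hjk hik hl
  obtain ⟨q, hq, y', hy', z', hz', hqy, hqz⟩ := h.exists_incidence hij hjk' hik' hl
  refine (h.isLine j l hl).le_of_mem (p := p) (q := q) ?_ hp hq (hc y hy hpy) (hc y' hy' hqy)
  rintro rfl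
  refine h.not_colorful ⟨p, fun m _ => ?_⟩
  obtain rfl | rfl | rfl | rfl := hall m
  exacts [⟨y, hy, hpy⟩, ⟨l, hl, hp⟩, ⟨z, hz, hpz⟩, ⟨z', hz', hqz⟩]

/-- A color class consists of any three distinct lines in it. -/
theorem eq_or_eq_or_eq (h : IsAdmissible L) {i : Fin 4} {x y z w : AffineSubspace ℝ Space}
    (hx : x ∈ L i) (hy : y ∈ L i) (hz : z ∈ L i) (hxy : x ≠ y) (hxz : x ≠ z) (hyz : y ≠ z)
    (hw : w ∈ L i) : w = x ∨ w = y ∨ w = z := by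
  have hfin : (L i).Finite := Set.finite_of_ncard_pos (by rw [h.card]; norm_num)
  have hsub : ({x, y, z} : Set (AffineSubspace ℝ Space)) ⊆ L i := by
    rintro _ (rfl | rfl | rfl) <;> assumption
  have heq := Set.eq_of_subset_of_ncard_le hsub
    (by rw [h.card, Set.ncard_eq_three.2 ⟨x, y, z, hxy, hxz, hyz, rfl⟩]) hfin
  rw [← heq] at hw
  simpa using hw

end IsAdmissible

/-! ### Uniqueness of incidences -/

namespace IsAdmissible

variable {L : Fin 4 → Set (AffineSubspace ℝ Space)} {a b c d x : AffineSubspace ℝ Space}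

theorem exists013 (h : IsAdmissible L) (ha : a ∈ L 0) :
    ∃ p ∈ a, ∃ b ∈ L 1, ∃ d ∈ L 3, p ∈ b ∧ p ∈ d :=
  h.exists_incidence (by decide) (by decide) (by decide) ha

theorem exists023 (h : IsAdmissible L) (ha : a ∈ L 0) :
    ∃ p ∈ a, ∃ c ∈ L 2, ∃ d ∈ L 3, p ∈ c ∧ p ∈ d :=
  h.exists_incidence (by decide) (by decide) (by decide) ha

theorem exists102 (h : IsAdmissible L) (hb : b ∈ L 1) :
    ∃ p ∈ b, ∃ a ∈ L 0, ∃ c ∈ L 2, p ∈ a ∧ p ∈ c :=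
  h.exists_incidence (by decide) (by decide) (by decide) hb

theorem exists103 (h : IsAdmissible L) (hb : b ∈ L 1) :
    ∃ p ∈ b, ∃ a ∈ L 0, ∃ d ∈ L 3, p ∈ a ∧ p ∈ d :=
  h.exists_incidence (by decide) (by decide) (by decide) hb

theorem exists123 (h : IsAdmissible L) (hb : b ∈ L 1) :
    ∃ p ∈ b, ∃ c ∈ L 2, ∃ d ∈ L 3, p ∈ c ∧ p ∈ d :=
  h.exists_incidence (by decide) (by decide) (by decide) hb

theorem exists201 (h : IsAdmissible L) (hc : c ∈ L 2) :
    ∃ p ∈ c, ∃ a ∈ L 0, ∃ b ∈ L 1, p ∈ a ∧ p ∈ b :=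
  h.exists_incidence (by decide) (by decide) (by decide) hc

theorem exists203 (h : IsAdmissible L) (hc : c ∈ L 2) :
    ∃ p ∈ c, ∃ a ∈ L 0, ∃ d ∈ L 3, p ∈ a ∧ p ∈ d :=
  h.exists_incidence (by decide) (by decide) (by decide) hc

theorem exists213 (h : IsAdmissible L) (hc : c ∈ L 2) :
    ∃ p ∈ c, ∃ b ∈ L 1, ∃ d ∈ L 3, p ∈ b ∧ p ∈ d :=
  h.exists_incidence (by decide) (by decide) (by decide) hc

theorem exists301 (h : IsAdmissible L) (hd : d ∈ L 3) :
    ∃ p ∈ d, ∃ a ∈ L 0, ∃ b ∈ L 1, p ∈ a ∧ p ∈ b :=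
  h.exists_incidence (by decide) (by decide) (by decide) hd

theorem exists302 (h : IsAdmissible L) (hd : d ∈ L 3) :
    ∃ p ∈ d, ∃ a ∈ L 0, ∃ c ∈ L 2, p ∈ a ∧ p ∈ c :=
  h.exists_incidence (by decide) (by decide) (by decide) hd

theorem exists312 (h : IsAdmissible L) (hd : d ∈ L 3) :
    ∃ p ∈ d, ∃ b ∈ L 1, ∃ c ∈ L 2, p ∈ b ∧ p ∈ c :=
  h.exists_incidence (by decide) (by decide) (by decide) hd

/-- Two distinct points of a line of color `0` cannot both carry an incidence of the colors
`0, 1, 2`; here it is assumed that the line of color `3` through the incidence of the colors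
`0, 1, 3` meets the first of the lines of color `1` in an incidence of the colors `1, 2, 3`. -/
theorem false_of_two_points_aux (h : IsAdmissible L)
    {a b₁ b₂ b₃ c₁ c₂ c₃ c d₁ d₂ : AffineSubspace ℝ Space} {p p' q r t : Space}
    (ha : a ∈ L 0) (hb₁ : b₁ ∈ L 1) (hb₂ : b₂ ∈ L 1) (hb₃ : b₃ ∈ L 1)
    (hc₁ : c₁ ∈ L 2) (hc₂ : c₂ ∈ L 2) (hc₃ : c₃ ∈ L 2) (hc : c ∈ L 2) (hd₁ : d₁ ∈ L 3)
    (hd₂ : d₂ ∈ L 3)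
    (b12 : b₁ ≠ b₂) (b13 : b₁ ≠ b₃) (b23 : b₂ ≠ b₃) (c12 : c₁ ≠ c₂) (c13 : c₁ ≠ c₃) (c23 : c₂ ≠ c₃)
    (d12 : d₁ ≠ d₂)
    (pa : p ∈ a) (pb : p ∈ b₁) (pc : p ∈ c₁) (pa' : p' ∈ a) (pb' : p' ∈ b₂) (pc' : p' ∈ c₂)
    (qa : q ∈ a) (qb : q ∈ b₃) (qd : q ∈ d₁) (ra : r ∈ a) (rc : r ∈ c₃) (rd : r ∈ d₂)
    (tb : t ∈ b₁) (tc : t ∈ c) (td : t ∈ d₁) : False := by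
  have hab : ∀ b ∈ L 1, ∃ s ∈ a, s ∈ b := by
    intro b hb
    rcases h.eq_or_eq_or_eq hb₁ hb₂ hb₃ b12 b13 b23 hb with rfl | rfl | rfl
    exacts [⟨p, pa, pb⟩, ⟨p', pa', pb'⟩, ⟨q, qa, qb⟩]
  have hac : ∀ c ∈ L 2, ∃ s ∈ a, s ∈ c := by
    intro c hc
    rcases h.eq_or_eq_or_eq hc₁ hc₂ hc₃ c12 c13 c23 hc with rfl | rfl | rfl
    exacts [⟨p, pa, pc⟩, ⟨p', pa', pc'⟩, ⟨r, ra, rc⟩]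
  obtain ⟨P, hP, aP, b₁P⟩ := exists_isPlane_of_lines (h.isLine 0 a ha) (h.isLine 1 b₁ hb₁)
    (h.disjoint (by decide) ha hb₁) pa pb
  -- Every line of color 1 or 2 meets `a`, so a second point in `P` off `a` puts it into `P`.
  have offb : ∀ b ∈ L 1, ∀ s ∈ b, s ∈ P → s ∉ a → b ≤ P := by
    intro b hb s sb sP sa
    obtain ⟨s', s'a, s'b⟩ := hab b hb
    exact (h.isLine 1 b hb).le_of_mem (p := s) (fun e => sa (e ▸ s'a)) sb s'b sP (aP s'a)
  have offc : ∀ c ∈ L 2, ∀ s ∈ c, s ∈ P → s ∉ a → c ≤ P := by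
    intro b hb s sb sP sa
    obtain ⟨s', s'a, s'b⟩ := hac b hb
    exact (h.isLine 2 b hb).le_of_mem (p := s) (fun e => sa (e ▸ s'a)) sb s'b sP (aP s'a)
  have ta : t ∉ a := fun ta => h.not_four ha hb₁ hc hd₁ ta tb tc td
  have d₁P : d₁ ≤ P := (h.isLine 3 d₁ hd₁).le_of_mem (p := t)
    (fun e => ta (e ▸ qa)) td qd (b₁P tb) (aP qa)
  have cP : c ≤ P := offc c hc t tc (b₁P tb) ta
  -- The two incidences `t` and `t'` on `d₁` give two different lines of color 2 in `P`, so exactly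
  -- one line `c''` of that color leaves `P`.
  obtain ⟨t', t'd, a', ha', c', hc', t'a', t'c'⟩ := h.exists302 hd₁
  have t'a : t' ∉ a := by
    intro t'a
    have := h.eq_point (by decide) ha hd₁ t'a t'd qa qd
    exact h.not_four ha hb₃ hc' hd₁ qa qb (this ▸ t'c') qd
  have c'P : c' ≤ P := offc c' hc' t' t'c' (d₁P t'd) t'a
  have cc' : c ≠ c' := by
    rintro rfl
    have := h.eq_point (by decide) hc hd₁ t'c' t'd tc td
    exact h.not_four ha' hb₁ hc hd₁ (this ▸ t'a') tb tc td
  obtain ⟨c'', hc'', c''P⟩ := h.exists_not_le 2 hP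
  have uniqc : ∀ x ∈ L 2, ¬ x ≤ P → x = c'' := by
    intro x hx hxP
    rcases h.eq_or_eq_or_eq hc hc' hc'' cc' (by rintro rfl; exact c''P cP)
      (by rintro rfl; exact c''P c'P) hx with rfl | rfl | rfl
    exacts [absurd cP hxP, absurd c'P hxP, rfl]
  -- lines of color 1 outside the plane meet the outer line of color 2 in a 123-point
  have out123 : ∀ b ∈ L 1, ¬ b ≤ P → ∃ s ∈ b, s ∈ c'' ∧ ∃ d ∈ L 3, s ∈ d := by
    intro b hb hbP
    obtain ⟨s, sb, x, hx, y, hy, sx, sy⟩ := h.exists123 hb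
    have : ¬ x ≤ P := fun hxP => hbP (offb b hb s sb (hxP sx)
      (fun sa => h.not_four ha hb hx hy sa sb sx sy))
    rw [uniqc x hx this] at sx
    exact ⟨s, sb, sx, y, hy, sy⟩
  have uniqb : ∀ b ∈ L 1, ¬ b ≤ P → b = b₂ := by
    intro b hb hbP
    rcases h.eq_or_eq_or_eq hb₁ hb₂ hb₃ b12 b13 b23 hb with rfl | rfl | rfl
    · exact absurd b₁P hbP
    · rfl
    -- If `b₃` left `P`, its incidences of the colors 1, 2, 3 and 0, 1, 2 would both lie on `c''`,
    -- hence coincide.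
    · exfalso
      obtain ⟨s, sb, sc, y, hy, sy⟩ := out123 b hb hbP
      obtain ⟨s', s'b, x, hx, z, hz, s'x, s'z⟩ := h.exists102 hb
      have : ¬ z ≤ P := fun hzP => hbP (offb b hb s' s'b (hzP s'z) (fun sa => by
        have := h.eq_point (by decide) ha hb sa s'b qa qb
        exact h.not_four ha hb hz hd₁ qa qb (this ▸ s'z) qd))
      rw [uniqc z hz this] at s'z
      have := h.eq_point (by decide) hb hc'' sb sc s'b s'z
      exact h.not_four hx hb hc'' hy s'x s'b s'z (this ▸ sy)
  obtain ⟨b'', hb'', b''P⟩ := h.exists_not_le 1 hP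
  obtain rfl := uniqb b'' hb'' b''P
  have bP : ∀ s ∈ b'', s ∈ P → s = p' := by
    intro s sb sP
    by_contra hs
    exact b''P ((h.isLine 1 _ hb'').le_of_mem hs sb pb' sP (aP pa'))
  -- The surviving outer line of color 1 meets `P` only in `p'`, through which no line of color 3
  -- passes. Its two incidences involving color 3 thus need two different lines of that color
  -- outside `P`, while `d₁` already lies in `P`.
  have d₂P : ¬ d₂ ≤ P := by
    intro d₂P
    obtain ⟨s, sb, x, hx, d, hd, sx, sd⟩ := h.exists103 hb''
    obtain ⟨s', s'b, c₀, hc₀, d', hd', s'c, s'd⟩ := h.exists123 hb''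
    have nd : ¬ d ≤ P := fun hdP => by
      have := bP s sb (hdP sd)
      exact h.not_four ha hb'' hc₂ hd pa' pb' pc' (this ▸ sd)
    have nd' : ¬ d' ≤ P := fun hdP => by
      have := bP s' s'b (hdP s'd)
      exact h.not_four ha hb'' hc₂ hd' pa' pb' pc' (this ▸ s'd)
    have hdd' : d ≠ d' := by
      rintro rfl
      have := h.eq_point (by decide) hb'' hd sb sd s'b s'd
      exact h.not_four hx hb'' hc₀ hd (this ▸ sx) s'b s'c s'd
    rcases h.eq_or_eq_or_eq hd₁ hd₂ hd d12 (by rintro rfl; exact nd d₁P)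
      (by rintro rfl; exact nd d₂P) hd' with rfl | rfl | rfl
    exacts [nd' d₁P, nd' d₂P, hdd' rfl]
  have dP : ∀ s ∈ d₂, s ∈ P → s = r := by
    intro s sb sP
    by_contra hs
    exact d₂P ((h.isLine 3 _ hd₂).le_of_mem hs sb rd sP (aP ra))
  -- Now `d₂` meets `P` only in `r`, which is on no line of color 1. Both incidences of `d₂` with
  -- color 1 are therefore on the unique outer line of that color and coincide.
  obtain ⟨s, sd, x, hx, b, hb, sx, sb⟩ := h.exists301 hd₂
  obtain ⟨s', s'd, b', hb', c₀, hc₀, s'b, s'c⟩ := h.exists312 hd₂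
  obtain rfl := uniqb b hb (fun hbP => by
    have := dP s sd (hbP sb)
    exact h.not_four ha hb hc₃ hd₂ ra (this ▸ sb) rc rd)
  obtain rfl := uniqb b' hb' (fun hbP => by
    have := dP s' s'd (hbP s'b)
    exact h.not_four ha hb' hc₃ hd₂ ra (this ▸ s'b) rc rd)
  have := h.eq_point (by decide) hb hd₂ sb sd s'b s'd
  exact h.not_four hx hb hc₀ hd₂ (this ▸ sx) s'b s'c s'd

/-- The incidences of `a` with color 3 supply the third lines of colors 1 and 2. The line `d₁` then
has its incidence of the colors 1, 2, 3 on `b₁` or `b₂`, not on `b₃`, which it already meets on `a`;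
the two cases are symmetric. -/
theorem false_of_two_points (h : IsAdmissible L) {a b₁ b₂ c₁ c₂ : AffineSubspace ℝ Space}
    {p p' : Space} (ha : a ∈ L 0) (hb₁ : b₁ ∈ L 1) (hb₂ : b₂ ∈ L 1)
    (hc₁ : c₁ ∈ L 2) (hc₂ : c₂ ∈ L 2) (hpp' : p ≠ p')
    (pa : p ∈ a) (pb : p ∈ b₁) (pc : p ∈ c₁) (pa' : p' ∈ a) (pb' : p' ∈ b₂) (pc' : p' ∈ c₂) :
    False := by
  have b12 : b₁ ≠ b₂ := by
    rintro rfl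
    exact hpp' (h.eq_point (by decide) ha hb₁ pa pb pa' pb')
  have c12 : c₁ ≠ c₂ := by
    rintro rfl
    exact hpp' (h.eq_point (by decide) ha hc₁ pa pc pa' pc')
  obtain ⟨q, qa, b₃, hb₃, d₁, hd₁, qb, qd⟩ := h.exists013 ha
  obtain ⟨r, ra, c₃, hc₃, d₂, hd₂, rc, rd⟩ := h.exists023 ha
  have b13 : b₁ ≠ b₃ := by
    rintro rfl
    have := h.eq_point (by decide) ha hb₁ pa pb qa qb
    exact h.not_four ha hb₁ hc₁ hd₁ qa qb (this ▸ pc) qd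
  have b23 : b₂ ≠ b₃ := by
    rintro rfl
    have := h.eq_point (by decide) ha hb₂ pa' pb' qa qb
    exact h.not_four ha hb₂ hc₂ hd₁ qa qb (this ▸ pc') qd
  have c13 : c₁ ≠ c₃ := by
    rintro rfl
    have := h.eq_point (by decide) ha hc₁ pa pc ra rc
    exact h.not_four ha hb₁ hc₁ hd₂ ra (this ▸ pb) rc rd
  have c23 : c₂ ≠ c₃ := by
    rintro rfl
    have := h.eq_point (by decide) ha hc₂ pa' pc' ra rc
    exact h.not_four ha hb₂ hc₂ hd₂ ra (this ▸ pb') rc rd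
  have d12 : d₁ ≠ d₂ := by
    rintro rfl
    have := h.eq_point (by decide) ha hd₁ qa qd ra rd
    exact h.not_four ha hb₃ hc₃ hd₁ ra (this ▸ qb) rc rd
  obtain ⟨t, td, b, hb, c, hc, tb, tc⟩ := h.exists312 hd₁
  rcases h.eq_or_eq_or_eq hb₁ hb₂ hb₃ b12 b13 b23 hb with rfl | rfl | rfl
  · exact h.false_of_two_points_aux ha hb₁ hb₂ hb₃ hc₁ hc₂ hc₃ hc hd₁ hd₂ b12 b13 b23 c12 c13 c23
      d12 pa pb pc pa' pb' pc' qa qb qd ra rc rd tb tc td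
  · exact h.false_of_two_points_aux ha hb₂ hb₁ hb₃ hc₂ hc₁ hc₃ hc hd₁ hd₂ b12.symm b23 b13 c12.symm
      c23 c13 d12 pa' pb' pc' pa pb pc qa qb qd ra rc rd tb tc td
  · have := h.eq_point (by decide) hb₃ hd₁ tb td qb qd
    exact h.not_four ha hb₃ hc hd₁ qa qb (this ▸ tc) qd

/-- The planar core of `false_of_two_lines`: `a₂` is the only line of color 0 outside `P`, so an
incidence with color 0 is in `P` unless it is on `a₂`. Lines leaving `P` have just one point in it,
and the contradiction arises on a line of color 2 whose point in `P` is on no line of color 0. -/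
theorem false_of_two_lines_aux (h : IsAdmissible L)
    {a₁ a₂ a₃ b₁ c₁ d : AffineSubspace ℝ Space} {p : Space} {P : AffineSubspace ℝ Space}
    (hP : IsPlane P) (ha₁ : a₁ ∈ L 0) (ha₂ : a₂ ∈ L 0) (ha₃ : a₃ ∈ L 0) (hb₁ : b₁ ∈ L 1)
    (hc₁ : c₁ ∈ L 2) (hd : d ∈ L 3) (a12 : a₁ ≠ a₂) (a13 : a₁ ≠ a₃) (a23 : a₂ ≠ a₃)
    (pa₂ : p ∈ a₂) (pb : p ∈ b₁) (pc : p ∈ c₁)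
    (a₁P : a₁ ≤ P) (a₃P : a₃ ≤ P) (b₁P : b₁ ≤ P) (c₁P : c₁ ≤ P) (dP : d ≤ P) : False := by
  have uniqa : ∀ a ∈ L 0, a ≠ a₂ → a ≤ P := by
    intro a ha hne
    rcases h.eq_or_eq_or_eq ha₁ ha₂ ha₃ a12 a13 a23 ha with rfl | rfl | rfl
    exacts [a₁P, absurd rfl hne, a₃P]
  have a₂P : ∀ s ∈ a₂, s ∈ P → s = p := by
    intro s sa sP
    by_contra hs
    have a₂P := (h.isLine 0 _ ha₂).le_of_mem hs sa pa₂ sP (b₁P pb)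
    obtain ⟨a, ha, haP⟩ := h.exists_not_le 0 hP
    exact haP (uniqa a ha (by rintro rfl; exact haP a₂P))
  obtain ⟨u, ua, b₂, hb₂, d₂, hd₂, ub, ud⟩ := h.exists013 ha₂
  obtain ⟨v, va, c₂, hc₂, d₃, hd₃, vc, vd⟩ := h.exists023 ha₂
  have uP : u ∉ P := fun uP => h.not_four ha₂ hb₁ hc₁ hd₂ pa₂ pb pc (a₂P u ua uP ▸ ud)
  have vP : v ∉ P := fun vP => h.not_four ha₂ hb₁ hc₁ hd₃ pa₂ pb pc (a₂P v va vP ▸ vd)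
  have d23 : d₂ ≠ d₃ := by
    rintro rfl
    have := h.eq_point (by decide) ha₂ hd₂ ua ud va vd
    exact h.not_four ha₂ hb₂ hc₂ hd₂ va (this ▸ ub) vc vd
  have dd₂ : d ≠ d₂ := by
    rintro rfl
    exact uP (dP ud)
  have dd₃ : d ≠ d₃ := by
    rintro rfl
    exact vP (dP vd)
  have uniq {i : Fin 4} {x : AffineSubspace ℝ Space} {w : Space} (hx : x ∈ L i) (wx : w ∈ x)
      (wP : w ∉ P) {s s' : Space} (sx : s ∈ x) (sP : s ∈ P) (s'x : s' ∈ x) (s'P : s' ∈ P) :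
      s = s' := by
    by_contra hs
    exact wP ((h.isLine i _ hx).le_of_mem hs sx s'x sP s'P wx)
  obtain ⟨w, wd, a, ha, c, hc, wa, wc⟩ := h.exists302 hd₂
  have wP : w ∈ P := by
    refine uniqa a ha ?_ wa
    rintro rfl
    have := h.eq_point (by decide) ha hd₂ wa wd ua ud
    exact h.not_four ha hb₂ hc hd₂ ua ub (this ▸ wc) ud
  obtain ⟨y, yd, a', ha', b, hb, ya, yb⟩ := h.exists301 hd₃
  have yP : y ∈ P := by
    refine uniqa a' ha' ?_ ya
    rintro rfl
    have := h.eq_point (by decide) ha' hd₃ ya yd va vd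
    exact h.not_four ha' hb hc₂ hd₃ va (this ▸ yb) vc vd
  obtain ⟨f, fb, a₄, ha₄, c₄, hc₄, fa, fc⟩ := h.exists102 hb₂
  have fP : f ∈ P := by
    refine uniqa a₄ ha₄ ?_ fa
    rintro rfl
    have := h.eq_point (by decide) ha₄ hb₂ fa fb ua ub
    exact h.not_four ha₄ hb₂ hc₄ hd₂ ua ub (this ▸ fc) ud
  obtain ⟨g, gc, a₅, ha₅, b₅, hb₅, ga, gb⟩ := h.exists201 hc₂
  have gP : g ∈ P := by
    refine uniqa a₅ ha₅ ?_ ga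
    rintro rfl
    have := h.eq_point (by decide) ha₅ hc₂ ga gc va vc
    exact h.not_four ha₅ hb₅ hc₂ hd₃ va (this ▸ gb) vc vd
  have d_cases : ∀ x ∈ L 3, x = d ∨ x = d₂ ∨ x = d₃ := fun x hx =>
    h.eq_or_eq_or_eq hd hd₂ hd₃ dd₂ dd₃ d23 hx
  -- the incidence of colors 1, 2, 3 on `b₂`
  obtain ⟨z, zb, c₃, hc₃, e, he, zc, ze⟩ := h.exists123 hb₂
  have zP : z ∉ P := by
    intro zP
    have := uniq hb₂ ub uP zb zP fb fP
    exact h.not_four ha₄ hb₂ hc₃ he fa fb (this ▸ zc) (this ▸ ze)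
  have ed₃ : e = d₃ := by
    rcases d_cases e he with rfl | rfl | rfl
    · exact absurd (dP ze) zP
    · have := h.eq_point (by decide) hb₂ he zb ze ub ud
      exact absurd (h.not_four ha₂ hb₂ hc₃ he ua ub (this ▸ zc) ud) id
    · rfl
  subst ed₃
  have c23 : c₃ ≠ c₂ := by
    rintro rfl
    have := h.eq_point (by decide) hc₃ he zc ze vc vd
    exact h.not_four ha₂ hb₂ hc₃ he va (this ▸ zb) vc vd
  have c13 : c₃ ≠ c₁ := by
    rintro rfl
    exact zP (c₁P zc)
  have c12 : c₁ ≠ c₂ := by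
    rintro rfl
    exact vP (c₁P vc)
  -- the incidence of colors 1, 2, 3 on `b₁`
  obtain ⟨t, tb, c₀, hc₀, e', he', tc, te⟩ := h.exists123 hb₁
  have tP : t ∈ P := b₁P tb
  have tnot : ∀ a ∈ L 0, t ∉ a := fun a ha ta => h.not_four ha hb₁ hc₀ he' ta tb tc te
  have c₀₃ : c₀ = c₃ := by
    rcases h.eq_or_eq_or_eq hc₁ hc₂ hc₃ c12 c13.symm c23.symm hc₀ with rfl | rfl | rfl
    · have := h.eq_point (by decide) hb₁ hc₀ tb tc pb pc
      exact absurd (this ▸ pa₂) (tnot a₂ ha₂)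
    · have := uniq hc₀ vc vP tc tP gc gP
      exact absurd (this ▸ ga) (tnot _ ha₅)
    · rfl
  subst c₀₃
  -- The only point of this line in `P` is `t`, which no line of color 0 contains. Both of its
  -- incidences with color 0 are therefore on `a₂`, hence equal.
  obtain ⟨m, mc, a₆, ha₆, b₆, hb₆, ma, mb⟩ := h.exists201 hc₀
  obtain ⟨n, nc, a₇, ha₇, d₇, hd₇, na, nd⟩ := h.exists203 hc₀
  have ht6 : a₆ = a₂ := by
    by_contra hne
    have := uniq hc₀ zc zP tc tP mc (uniqa a₆ ha₆ hne ma)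
    exact tnot a₆ ha₆ (this ▸ ma)
  have ht7 : a₇ = a₂ := by
    by_contra hne
    have := uniq hc₀ zc zP tc tP nc (uniqa a₇ ha₇ hne na)
    exact tnot a₇ ha₇ (this ▸ na)
  subst ht6
  subst ht7
  have := h.eq_point (by decide) ha₆ hc₀ ma mc na nc
  exact h.not_four ha₆ hb₆ hc₀ hd₇ na (this ▸ mb) nc nd

/-- Through `p` passes no line of color 3, so the incidences of `b₁` and `c₁` with colors 0 and 3
are both on the third line `a₃` of color 0. Thus `a₃`, `b₁`, `c₁` span a plane; it remains to find a
line of color 3 and one of `a₁`, `a₂` in it. -/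
theorem false_of_two_lines (h : IsAdmissible L) {a₁ a₂ b₁ c₁ : AffineSubspace ℝ Space}
    {p : Space} (ha₁ : a₁ ∈ L 0) (ha₂ : a₂ ∈ L 0) (hb₁ : b₁ ∈ L 1)
    (hc₁ : c₁ ∈ L 2) (a12 : a₁ ≠ a₂) (pa₁ : p ∈ a₁) (pa₂ : p ∈ a₂) (pb : p ∈ b₁) (pc : p ∈ c₁) :
    False := by
  have pd : ∀ d ∈ L 3, p ∉ d := fun d hd pd => h.not_four ha₁ hb₁ hc₁ hd pa₁ pb pc pd
  obtain ⟨q, qb, a₃, ha₃, d₁, hd₁, qa, qd₁⟩ := h.exists103 hb₁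
  have hqp : q ≠ p := fun e => pd d₁ hd₁ (e ▸ qd₁)
  have a13 : a₁ ≠ a₃ := by
    rintro rfl
    exact hqp (h.eq_point (by decide) ha₁ hb₁ qa qb pa₁ pb)
  have a23 : a₂ ≠ a₃ := by
    rintro rfl
    exact hqp (h.eq_point (by decide) ha₂ hb₁ qa qb pa₂ pb)
  obtain ⟨r, rc, a, ha, d₂, hd₂, ra, rd₂⟩ := h.exists203 hc₁
  have hrp : r ≠ p := fun e => pd d₂ hd₂ (e ▸ rd₂)
  have haa : a = a₃ := by
    rcases h.eq_or_eq_or_eq ha₁ ha₂ ha₃ a12 a13 a23 ha with rfl | rfl | rfl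
    · exact absurd (h.eq_point (by decide) ha hc₁ ra rc pa₁ pc) hrp
    · exact absurd (h.eq_point (by decide) ha hc₁ ra rc pa₂ pc) hrp
    · rfl
  subst haa
  obtain ⟨P, hP, a₃P, b₁P⟩ := exists_isPlane_of_lines (h.isLine 0 a ha) (h.isLine 1 b₁ hb₁)
    (h.disjoint (by decide) ha hb₁) qa qb
  have c₁P : c₁ ≤ P := (h.isLine 2 c₁ hc₁).le_of_mem hrp rc pc (a₃P ra) (b₁P pb)
  obtain ⟨t, tb, c₃, hc₃, d₃, hd₃, tc, td₃⟩ := h.exists123 hb₁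
  obtain ⟨t', t'c, b₄, hb₄, d₄, hd₄, t'b, td₄⟩ := h.exists213 hc₁
  -- Pigeonhole: the points `q`, `r`, `t`, `t'` of `P` are on lines of color 3, of which there are
  -- only three. The forbidden equalities leave a line passing through two different points among
  -- them.
  have hd : ∃ d ∈ L 3, d ≤ P := by
    have d12 : d₁ ≠ d₂ := by
      rintro rfl
      have := h.eq_point (by decide) ha hd₁ qa qd₁ ra rd₂
      exact h.not_four ha hb₁ hc₁ hd₁ ra (this ▸ qb) rc rd₂
    have d13 : d₁ ≠ d₃ := by
      rintro rfl
      have := h.eq_point (by decide) hb₁ hd₁ qb qd₁ tb td₃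
      exact h.not_four ha hb₁ hc₃ hd₁ qa qb (this ▸ tc) qd₁
    have d24 : d₂ ≠ d₄ := by
      rintro rfl
      have := h.eq_point (by decide) hc₁ hd₂ rc rd₂ t'c td₄
      exact h.not_four ha hb₄ hc₁ hd₂ ra (this ▸ t'b) rc rd₂
    by_cases d23 : d₂ = d₃
    · subst d23
      refine ⟨d₂, hd₂, (h.isLine 3 d₂ hd₂).le_of_mem (p := r) (q := t) ?_ rd₂ td₃ (a₃P ra)
        (b₁P tb)⟩
      rintro rfl
      exact h.not_four ha hb₁ hc₁ hd₂ ra tb rc rd₂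
    rcases h.eq_or_eq_or_eq hd₁ hd₂ hd₃ d12 d13 d23 hd₄ with rfl | rfl | rfl
    · refine ⟨d₄, hd₁, (h.isLine 3 d₄ hd₁).le_of_mem (p := q) (q := t') ?_ qd₁ td₄ (a₃P qa)
        (c₁P t'c)⟩
      rintro rfl
      exact h.not_four ha hb₁ hc₁ hd₁ qa qb t'c qd₁
    · exact absurd rfl d24
    · refine ⟨d₄, hd₄, (h.isLine 3 d₄ hd₄).le_of_mem (p := t) (q := t') ?_ td₃ td₄ (b₁P tb)
        (c₁P t'c)⟩
      rintro rfl
      have := h.eq_point (by decide) hb₁ hc₁ tb t'c pb pc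
      exact pd d₄ hd₄ (this ▸ td₃)
  obtain ⟨d, hd, dP⟩ := hd
  obtain ⟨m, md, a₅, ha₅, b₅, hb₅, ma, mb⟩ := h.exists301 hd
  obtain ⟨n, nd, a₆, ha₆, c₆, hc₆, na, nc⟩ := h.exists302 hd
  -- The two incidences of `d` with color 0 cannot both be on `a₃`. A meeting point with `a₁` or
  -- `a₂` is different from `p` and puts that line into `P`.
  have key : ∀ x ∈ L 0, ∀ s ∈ d, s ∈ x → x ≠ a → False := by
    intro x hx s sd sx hxa
    have hsp : s ≠ p := fun e => pd d hd (e ▸ sd)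
    rcases h.eq_or_eq_or_eq ha₁ ha₂ ha₃ a12 a13 a23 hx with rfl | rfl | rfl
    · exact h.false_of_two_lines_aux hP hx ha₂ ha₃ hb₁ hc₁ hd a12 a13 a23 pa₂ pb pc
        ((h.isLine 0 x hx).le_of_mem hsp sx pa₁ (dP sd) (b₁P pb)) a₃P b₁P c₁P dP
    · exact h.false_of_two_lines_aux hP hx ha₁ ha₃ hb₁ hc₁ hd a12.symm a23 a13 pa₁ pb pc
        ((h.isLine 0 x hx).le_of_mem hsp sx pa₂ (dP sd) (b₁P pb)) a₃P b₁P c₁P dP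
    · exact hxa rfl
  by_cases h5 : a₅ = a
  · by_cases h6 : a₆ = a
    · subst h5
      subst h6
      have := h.eq_point (by decide) ha₅ hd ma md na nd
      exact h.not_four ha₅ hb₅ hc₆ hd na (this ▸ mb) nc nd
    · exact key a₆ ha₆ n nd na h6
  · exact key a₅ ha₅ m md ma h5

end IsAdmissible

/-- Three subspaces have a common point. -/
def Concurrent (x y z : AffineSubspace ℝ Space) : Prop := ∃ p, p ∈ x ∧ p ∈ y ∧ p ∈ z

namespace Concurrent

variable {x y z : AffineSubspace ℝ Space}

theorem swap (h : Concurrent x y z) : Concurrent y x z := by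
  obtain ⟨p, h₁, h₂, h₃⟩ := h
  exact ⟨p, h₂, h₁, h₃⟩

theorem rotate (h : Concurrent x y z) : Concurrent y z x := by
  obtain ⟨p, h₁, h₂, h₃⟩ := h
  exact ⟨p, h₂, h₃, h₁⟩

end Concurrent

/-! ### Matchings between color classes and cyclic labels -/

namespace IsAdmissible

variable {L : Fin 4 → Set (AffineSubspace ℝ Space)}

theorem false_of_mem_four (h : IsAdmissible L) {i j k l : Fin 4}
    (hall : ∀ m, m = i ∨ m = j ∨ m = k ∨ m = l) {x y z w : AffineSubspace ℝ Space} {p : Space}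
    (hx : x ∈ L i) (hy : y ∈ L j) (hz : z ∈ L k) (hw : w ∈ L l)
    (px : p ∈ x) (py : p ∈ y) (pz : p ∈ z) (pw : p ∈ w) : False := by
  refine h.not_colorful ⟨p, fun m _ => ?_⟩
  obtain rfl | rfl | rfl | rfl := hall m
  exacts [⟨x, hx, px⟩, ⟨y, hy, py⟩, ⟨z, hz, pz⟩, ⟨w, hw, pw⟩]

theorem false_of_concurrent (h : IsAdmissible L) {i j k l : Fin 4}
    (hij : i ≠ j) (hall : ∀ m, m = i ∨ m = j ∨ m = k ∨ m = l) {x y z w : AffineSubspace ℝ Space}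
    (hx : x ∈ L i) (hy : y ∈ L j) (hz : z ∈ L k) (hw : w ∈ L l)
    (h₁ : Concurrent x y z) (h₂ : Concurrent x y w) : False := by
  obtain ⟨p, px, py, pz⟩ := h₁
  obtain ⟨q, qx, qy, qw⟩ := h₂
  exact h.false_of_mem_four hall hx hy hz hw px py pz
    (h.eq_point hij hx hy px py qx qy ▸ qw)

theorem exists_perm_of_ne {i j k : Fin 4} (hij : i ≠ j) (hik : i ≠ k) (hjk : j ≠ k) :
    ∃ σ : Equiv.Perm (Fin 4), σ 0 = i ∧ σ 1 = j ∧ σ 2 = k := by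
  revert i j k
  decide

theorem point_unique (h : IsAdmissible L) {i j k : Fin 4} (hij : i ≠ j) (hik : i ≠ k)
    (hjk : j ≠ k) {x y z y' z' : AffineSubspace ℝ Space} {p q : Space} (hx : x ∈ L i)
    (hy : y ∈ L j) (hz : z ∈ L k) (hy' : y' ∈ L j) (hz' : z' ∈ L k)
    (px : p ∈ x) (py : p ∈ y) (pz : p ∈ z) (qx : q ∈ x) (qy : q ∈ y') (qz : q ∈ z') : p = q := by
  obtain ⟨σ, rfl, rfl, rfl⟩ := exists_perm_of_ne hij hik hjk
  by_contra hpq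
  exact (h.comp_perm σ).false_of_two_points hx hy hy' hz hz' hpq px py pz qx qy qz

theorem line_unique (h : IsAdmissible L) {i j k : Fin 4} (hij : i ≠ j) (hik : i ≠ k)
    (hjk : j ≠ k) {x x' y z : AffineSubspace ℝ Space} {p : Space} (hx : x ∈ L i) (hx' : x' ∈ L i)
    (hy : y ∈ L j) (hz : z ∈ L k) (px : p ∈ x) (px' : p ∈ x') (py : p ∈ y) (pz : p ∈ z) :
    x = x' := by
  obtain ⟨σ, rfl, rfl, rfl⟩ := exists_perm_of_ne hij hik hjk
  by_contra hxx
  exact (h.comp_perm σ).false_of_two_lines hx hx' hy hz hxx px px' py pz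

theorem range_eq (h : IsAdmissible L) {i : Fin 4} {y : Fin 3 → AffineSubspace ℝ Space}
    (hy : ∀ n, y n ∈ L i) (hinj : Function.Injective y) : Set.range y = L i := by
  have hfin : (L i).Finite := Set.finite_of_ncard_pos (by rw [h.card]; norm_num)
  refine Set.eq_of_subset_of_ncard_le (Set.range_subset_iff.2 hy) ?_ hfin
  rw [h.card, ← Set.image_univ, Set.ncard_image_of_injective _ hinj]
  simp

/-- The incidences of three colors match the lines of the three color classes. -/
theorem exists_matching (h : IsAdmissible L) {i j k : Fin 4} (hij : i ≠ j) (hik : i ≠ k)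
    (hjk : j ≠ k) {x : Fin 3 → AffineSubspace ℝ Space} (hx : ∀ n, x n ∈ L i)
    (hinj : Function.Injective x) :
    ∃ y z : Fin 3 → AffineSubspace ℝ Space, (∀ n, y n ∈ L j) ∧ Function.Injective y ∧
      (∀ n, z n ∈ L k) ∧ Function.Injective z ∧ ∀ n, Concurrent (x n) (y n) (z n) := by
  choose p hp y hy z hz hpy hpz using fun n => h.exists_incidence hij hik hjk (hx n)
  refine ⟨y, z, hy, ?_, hz, ?_, fun n => ⟨p n, hp n, hpy n, hpz n⟩⟩
  -- On a common line of color `j` the two incidences coincide by `point_unique`; then `line_unique`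
  -- identifies the lines of color `i`.
  · intro m n hmn
    have e : p m = p n := h.point_unique hij.symm hjk hik (hy m) (hx m) (hz m) (hx n) (hz n)
      (hpy m) (hp m) (hpz m) (hmn ▸ hpy n) (hp n) (hpz n)
    exact hinj (h.line_unique hij hik hjk (hx m) (hx n) (hy m) (hz m) (hp m) (e ▸ hp n) (hpy m)
      (hpz m))
  · intro m n hmn
    have e : p m = p n := h.point_unique hik.symm hjk.symm hij (hz m) (hx m) (hy m) (hx n) (hy n)
      (hpz m) (hp m) (hpy m) (hmn ▸ hpz n) (hp n) (hpy n)
    exact hinj (h.line_unique hij hik hjk (hx m) (hx n) (hy m) (hz m) (hp m) (e ▸ hp n) (hpy m)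
      (hpz m))

theorem exists_index (h : IsAdmissible L) {i : Fin 4} {y z : Fin 3 → AffineSubspace ℝ Space}
    (hy : ∀ n, y n ∈ L i) (hyinj : Function.Injective y) (hz : ∀ n, z n ∈ L i)
    (hzinj : Function.Injective z) :
    ∃ f : Fin 3 → Fin 3, Function.Injective f ∧ ∀ n, z n = y (f n) := by
  have hr := h.range_eq hy hyinj
  have : ∀ n, ∃ m, y m = z n := fun n => by
    have := hz n
    rwa [← hr] at this
  choose f hf using this
  refine ⟨f, fun m n hmn => hzinj ?_, fun n => (hf n).symm⟩
  rw [← hf, ← hf, hmn]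

end IsAdmissible

/-- After subtracting `s`, the map is a permutation of three elements without fixed points, that is,
a 3-cycle and hence a translation. -/
theorem exists_shift_of_injective {f : Fin 3 → Fin 3} (hf : Function.Injective f)
    (h : ∃ s : Fin 3, ∀ n, f n ≠ n + s) : ∃ s : Fin 3, ∀ n, f n = n + s := by
  revert f
  decide

/-- The lines `a n, b n, c n, d n` of the four color classes are labelled by `n` modulo 3 so that
the incidences of any three colors are invariant under the translations of the labels. -/
structure IsCyclicLabelling (L : Fin 4 → Set (AffineSubspace ℝ Space))
    (a b c d : Fin 3 → AffineSubspace ℝ Space) (s t u v : Fin 3) : Prop where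
  mem_a : ∀ n, a n ∈ L 0
  mem_b : ∀ n, b n ∈ L 1
  mem_c : ∀ n, c n ∈ L 2
  mem_d : ∀ n, d n ∈ L 3
  inj_a : Function.Injective a
  inj_b : Function.Injective b
  inj_c : Function.Injective c
  inj_d : Function.Injective d
  abc : ∀ n, Concurrent (a n) (b n) (c n)
  abd : ∀ n, Concurrent (a n) (b (n + 1)) (d n)
  acd : ∀ n, Concurrent (a n) (c (n + s)) (d (n + t))
  bcd : ∀ n, Concurrent (b n) (c (n + u)) (d (n + v))

namespace IsAdmissible

variable {L : Fin 4 → Set (AffineSubspace ℝ Space)}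

theorem exists_labels (h : IsAdmissible L) : ∃ a b c d : Fin 3 → AffineSubspace ℝ Space,
    (∀ n, a n ∈ L 0) ∧ (∀ n, b n ∈ L 1) ∧ (∀ n, c n ∈ L 2) ∧ (∀ n, d n ∈ L 3) ∧
    Function.Injective a ∧ Function.Injective b ∧ Function.Injective c ∧ Function.Injective d ∧
    (∀ n, Concurrent (a n) (b n) (c n)) ∧ ∀ n, Concurrent (a n) (b (n + 1)) (d n) := by
  obtain ⟨x, y, z, hxy, hxz, hyz, hL⟩ := Set.ncard_eq_three.1 (h.card 0)
  have ha : ∀ n, ![x, y, z] n ∈ L 0 := by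
    intro n
    rw [hL]
    fin_cases n <;> simp
  have hinj : Function.Injective ![x, y, z] := by
    intro m n hmn
    fin_cases m <;> fin_cases n <;> simp_all
  generalize ![x, y, z] = a at ha hinj
  obtain ⟨b, c, hb, hbinj, hc, hcinj, habc⟩ := h.exists_matching (by decide) (by decide)
    (by decide) (j := 1) (k := 2) ha hinj
  obtain ⟨b', d, hb', hb'inj, hd, hdinj, habd⟩ := h.exists_matching (by decide) (by decide)
    (by decide) (j := 1) (k := 3) ha hinj
  obtain ⟨f, hf, hbf⟩ := h.exists_index hb hbinj hb' hb'inj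
  have hne : ∀ n, f n ≠ n := by
    intro n hn
    have h2 := habd n
    rw [hbf, hn] at h2
    exact h.false_of_concurrent (by decide) (by decide) (ha n) (hb n) (hc n) (hd n) (habc n) h2
  obtain ⟨s, hs⟩ := exists_shift_of_injective hf ⟨0, by simpa using hne⟩
  have hs0 : s ≠ 0 := by
    rintro rfl
    exact hne 0 (by simp [hs])
  have habd' : ∀ n, Concurrent (a n) (b (n + s)) (d n) := fun n => by
    rw [← hs, ← hbf]
    exact habd n
  obtain rfl | rfl : s = 1 ∨ s = 2 := by
    revert hs0
    clear * -
    revert s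
    decide
  · exact ⟨a, b, c, d, ha, hb, hc, hd, hinj, hbinj, hcinj, hdinj, habc, habd'⟩
  -- Negating all labels turns the shift 2 into 1.
  · refine ⟨fun n => a (-n), fun n => b (-n), fun n => c (-n), fun n => d (-n), fun n => ha _,
      fun n => hb _, fun n => hc _, fun n => hd _, hinj.comp neg_injective,
      hbinj.comp neg_injective, hcinj.comp neg_injective, hdinj.comp neg_injective,
      fun n => habc _, fun n => ?_⟩
    have e : -(n + 1) = -n + 2 := by
      revert n
      decide
    beta_reduce
    rw [e]
    exact habd' _

/-- Each pair of colors belongs to two triples, and the two matchings must pair the lines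
differently, or an incidence of all colors results. The pair of colors 0, 1 is settled by the labels
of `exists_labels`; the other five pairs give the five inequalities. -/
theorem exists_cyclicLabelling (h : IsAdmissible L) :
    ∃ a b c d : Fin 3 → AffineSubspace ℝ Space, ∃ s t u v : Fin 3,
      s ≠ 0 ∧ t ≠ 0 ∧ u ≠ 0 ∧ v ≠ 2 ∧ t - s ≠ v - u ∧ IsCyclicLabelling L a b c d s t u v := by
  obtain ⟨a, b, c, d, ha, hb, hc, hd, ia, ib, ic, id, habc, habd⟩ := h.exists_labels
  obtain ⟨c', d', hc', ic', hd', id', hacd⟩ := h.exists_matching (by decide) (by decide)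
    (by decide) (j := 2) (k := 3) ha ia
  obtain ⟨c'', d'', hc'', ic'', hd'', id'', hbcd⟩ := h.exists_matching (by decide) (by decide)
    (by decide) (j := 2) (k := 3) hb ib
  obtain ⟨fs, hfs, efs⟩ := h.exists_index hc ic hc' ic'
  obtain ⟨ft, hft, eft⟩ := h.exists_index hd id hd' id'
  obtain ⟨fu, hfu, efu⟩ := h.exists_index hc ic hc'' ic''
  obtain ⟨fv, hfv, efv⟩ := h.exists_index hd id hd'' id''
  have nes : ∀ n, fs n ≠ n + 0 := fun n hn => by
    have h2 := hacd n
    rw [efs, hn, add_zero] at h2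
    exact h.false_of_concurrent (i := 0) (j := 2) (k := 1) (l := 3) (by decide) (by decide) (ha n)
      (hc n) (hb n) (hd' n) (habc n).swap.rotate h2
  have net : ∀ n, ft n ≠ n + 0 := fun n hn => by
    have h2 := hacd n
    rw [eft, hn, add_zero] at h2
    exact h.false_of_concurrent (i := 0) (j := 3) (k := 1) (l := 2) (by decide) (by decide) (ha n)
      (hd n) (hb _) (hc' n) (habd n).swap.rotate h2.swap.rotate
  have neu : ∀ n, fu n ≠ n + 0 := fun n hn => by
    have h2 := hbcd n
    rw [efu, hn, add_zero] at h2
    exact h.false_of_concurrent (i := 1) (j := 2) (k := 0) (l := 3) (by decide) (by decide) (hb n)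
      (hc n) (ha n) (hd'' n) (habc n).rotate h2
  have nev : ∀ n, fv n ≠ n + 2 := fun n hn => by
    have h2 := hbcd n
    have e : ∀ m : Fin 3, m + 2 + 1 = m := by decide
    have h3 := habd (n + 2)
    rw [e] at h3
    rw [efv, hn] at h2
    exact h.false_of_concurrent (i := 1) (j := 3) (k := 0) (l := 2) (by decide) (by decide) (hb n)
      (hd (n + 2)) (ha _) (hc'' n) h3.rotate h2.swap.rotate
  obtain ⟨s, hs⟩ := exists_shift_of_injective hfs ⟨0, nes⟩
  obtain ⟨t, ht⟩ := exists_shift_of_injective hft ⟨0, net⟩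
  obtain ⟨u, hu⟩ := exists_shift_of_injective hfu ⟨0, neu⟩
  obtain ⟨v, hv⟩ := exists_shift_of_injective hfv ⟨2, nev⟩
  have acd : ∀ n, Concurrent (a n) (c (n + s)) (d (n + t)) := fun n => by
    rw [← hs, ← ht, ← efs, ← eft]
    exact hacd n
  have bcd : ∀ n, Concurrent (b n) (c (n + u)) (d (n + v)) := fun n => by
    rw [← hu, ← hv, ← efu, ← efv]
    exact hbcd n
  refine ⟨a, b, c, d, s, t, u, v, ?_, ?_, ?_, ?_, ?_, ⟨ha, hb, hc, hd, ia, ib, ic, id, habc, habd,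
    acd, bcd⟩⟩
  · rintro rfl
    exact nes 0 (hs 0)
  · rintro rfl
    exact net 0 (ht 0)
  · rintro rfl
    exact neu 0 (hu 0)
  · rintro rfl
    exact nev 0 (hv 0)
  · intro e
    have h1 := acd u
    have h2 := bcd s
    have key : ∀ s t u v : Fin 3, t - s = v - u → u + t = s + v := by decide
    rw [key s t u v e, add_comm u s] at h1
    exact h.false_of_concurrent (i := 2) (j := 3) (k := 0) (l := 1) (by decide) (by decide) (hc _)
      (hd _) (ha _) (hb _) h1.rotate h2.rotate

end IsAdmissible

/-- Up to a permutation of the colors, `L` has a cyclic labelling with the shifts `s, t, u, v`. -/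
def HasType (L : Fin 4 → Set (AffineSubspace ℝ Space)) (s t u v : Fin 3) : Prop :=
  ∃ σ : Equiv.Perm (Fin 4), ∃ a b c d : Fin 3 → AffineSubspace ℝ Space,
    IsCyclicLabelling (fun i => L (σ i)) a b c d s t u v

/-! ### Recoloring a cyclic labelling -/

namespace HasType

variable {L : Fin 4 → Set (AffineSubspace ℝ Space)} {s t u v : Fin 3}

theorem swap_zero_one (h : HasType L s t u v) : HasType L (-u) (-v - 1) (-s) (-t - 1) := by
  obtain ⟨σ, a, b, c, d, h⟩ := h
  refine ⟨(Equiv.swap 0 1).trans σ, fun n => b (-n), fun n => a (-n), fun n => c (-n),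
    fun n => d (-n - 1), fun n => h.mem_b _, fun n => h.mem_a _, fun n => h.mem_c _,
    fun n => h.mem_d _, h.inj_b.comp neg_injective, h.inj_a.comp neg_injective,
    h.inj_c.comp neg_injective, h.inj_d.comp fun m n hmn => by simpa using hmn, fun n => ?_,
    fun n => ?_, fun n => ?_, fun n => ?_⟩
  · exact (h.abc (-n)).swap
  · convert (h.abd (-n - 1)).swap using 2 <;> grind
  · convert h.bcd (-n) using 2 <;> grind
  · convert h.acd (-n) using 2 <;> grind

/-- Exchanging the colors makes `s` the shift that is normalized to 1, so labels are rescaled by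
`s`, which is its own inverse modulo 3. The offset `t` in the labels of `d` restores the
normalization of color 3. -/
theorem swap_one_two (hs : s ≠ 0) (h : HasType L s t u v) :
    HasType L s (-s * t) (-s * u) (s * (v - u - t)) := by
  obtain ⟨σ, a, b, c, d, h⟩ := h
  have hinj : Function.Injective fun n => s * n := by
    clear h
    revert s
    decide
  have hinj' : Function.Injective fun n => s * n + t := fun m n hmn => hinj (by simpa using hmn)
  refine ⟨(Equiv.swap 1 2).trans σ, fun n => a (s * n), fun n => c (s * n), fun n => b (s * n),
    fun n => d (s * n + t), fun n => h.mem_a _, fun n => h.mem_c _, fun n => h.mem_b _,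
    fun n => h.mem_d _, h.inj_a.comp hinj, h.inj_c.comp hinj, h.inj_b.comp hinj,
    h.inj_d.comp hinj', fun n => ?_, fun n => ?_, fun n => ?_, fun n => ?_⟩
  · exact (h.abc (s * n)).swap.rotate
  · convert h.acd (s * n) using 2
    clear * -
    revert s n
    decide
  · convert h.abd (s * n) using 2 <;> · clear * - hs; revert s t n; decide
  · convert (h.bcd (s * n - u)).swap using 2 <;> · clear * - hs; revert s t u v n; decide

theorem swap_two_three (h : HasType L s t u v) : HasType L (-t) (-s) (-1 - v) (-1 - u) := by
  obtain ⟨σ, a, b, c, d, h⟩ := h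
  refine ⟨(Equiv.swap 2 3).trans σ, fun n => a (-n), fun n => b (-n + 1), fun n => d (-n),
    fun n => c (-n), fun n => h.mem_a _, fun n => h.mem_b _, fun n => h.mem_d _,
    fun n => h.mem_c _, h.inj_a.comp neg_injective,
    h.inj_b.comp fun m n hmn => by simpa using hmn, h.inj_d.comp neg_injective,
    h.inj_c.comp neg_injective, fun n => ?_, fun n => ?_, fun n => ?_, fun n => ?_⟩
  · exact h.abd (-n)
  · convert h.abc (-n) using 2
    clear * -
    revert n
    decide
  · convert (h.acd (-n)).swap.rotate using 2 <;> · clear * -; revert s t n; decide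
  · convert (h.bcd (-n + 1)).swap.rotate using 2 <;> · clear * -; revert u v n; decide

end HasType

/-- The inequalities of `exists_cyclicLabelling` leave eleven quadruples of shifts; adjacent
transpositions of the colors bring each to one of three representatives. -/
theorem IsAdmissible.hasType {L : Fin 4 → Set (AffineSubspace ℝ Space)} (h : IsAdmissible L) :
    HasType L 1 1 1 0 ∨ HasType L 2 1 2 0 ∨ HasType L 2 1 1 1 := by
  obtain ⟨a, b, c, d, s, t, u, v, hs, ht, hu, hv, hne, hl⟩ := h.exists_cyclicLabelling
  have key : HasType L s t u v := ⟨Equiv.refl _, a, b, c, d, hl⟩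
  have p₁ : HasType L 1 2 2 1 → HasType L 1 1 1 0 := fun h => h.swap_one_two (by decide)
  have p₂ : HasType L 1 2 1 0 → HasType L 1 1 1 0 := fun h => p₁ h.swap_two_three
  have d₁ : HasType L 1 2 1 1 → HasType L 2 1 2 0 := fun h => h.swap_zero_one
  have d₂ : HasType L 1 1 2 1 → HasType L 2 1 2 0 := fun h => d₁ (h.swap_one_two (by decide))
  have types : ∀ s t u v : Fin 3, s ≠ 0 → t ≠ 0 → u ≠ 0 → v ≠ 2 → t - s ≠ v - u →
      (s, t, u, v) ∈ [((1, 1, 1, 0) : Fin 3 × Fin 3 × Fin 3 × Fin 3), (1, 1, 2, 0), (1, 1, 2, 1),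
        (1, 2, 1, 0), (1, 2, 1, 1), (1, 2, 2, 1), (2, 1, 1, 1), (2, 1, 2, 0), (2, 2, 1, 0),
        (2, 2, 2, 0), (2, 2, 2, 1)] := by decide
  have := types s t u v hs ht hu hv hne
  simp only [List.mem_cons, Prod.mk.injEq, List.not_mem_nil, or_false] at this
  rcases this with ⟨rfl, rfl, rfl, rfl⟩ | ⟨rfl, rfl, rfl, rfl⟩ | ⟨rfl, rfl, rfl, rfl⟩ |
    ⟨rfl, rfl, rfl, rfl⟩ | ⟨rfl, rfl, rfl, rfl⟩ | ⟨rfl, rfl, rfl, rfl⟩ | ⟨rfl, rfl, rfl, rfl⟩ |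
    ⟨rfl, rfl, rfl, rfl⟩ | ⟨rfl, rfl, rfl, rfl⟩ | ⟨rfl, rfl, rfl, rfl⟩ | ⟨rfl, rfl, rfl, rfl⟩
  · exact Or.inl key
  · exact Or.inl (p₂ (key.swap_one_two (by decide)))
  · exact Or.inr (Or.inl (d₂ key))
  · exact Or.inl (p₂ key)
  · exact Or.inr (Or.inl (d₁ key))
  · exact Or.inl (p₁ key)
  · exact Or.inr (Or.inr key)
  · exact Or.inr (Or.inl key)
  · exact Or.inr (Or.inl (d₂ key.swap_two_three))
  · exact Or.inl (p₂ key.swap_zero_one)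
  · exact Or.inl key.swap_two_three

/-- A cyclic labelling with the shifts `1, 1, 1, 0` forces the lines to be coplanar. -/
theorem IsAdmissible.not_hasType {L : Fin 4 → Set (AffineSubspace ℝ Space)} (h : IsAdmissible L) :
    ¬ HasType L 1 1 1 0 := by
  rintro ⟨σ, a, b, c, d, hl⟩
  replace h := h.comp_perm σ
  generalize (fun i => L (σ i)) = M at h hl
  choose p pa pb pc using hl.abc
  choose q qa qb qd using hl.abd
  choose r ra rc rd using hl.acd
  choose s sb sc sd using hl.bcd
  have four : ∀ {x i j k l}, x ∈ a i → x ∈ b j → x ∈ c k → x ∈ d l → False :=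
    fun h₁ h₂ h₃ h₄ => h.not_four (hl.mem_a _) (hl.mem_b _) (hl.mem_c _) (hl.mem_d _) h₁ h₂ h₃ h₄
  have la := fun n => h.isLine 0 _ (hl.mem_a n)
  have lb := fun n => h.isLine 1 _ (hl.mem_b n)
  have lc := fun n => h.isLine 2 _ (hl.mem_c n)
  have ld := fun n => h.isLine 3 _ (hl.mem_d n)
  obtain ⟨P, hP, a₀, b₀⟩ := exists_isPlane_of_lines (la 0) (lb 0)
    (h.disjoint (by decide) (hl.mem_a 0) (hl.mem_b 0)) (pa 0) (pb 0)
  -- From here on each line meets two lines already in `P`, in points that are distinct because they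
  -- carry incidences of different color triples.
  have c₁ : c 1 ≤ P := (lc 1).le_of_mem
    (fun e => four (ra 0) (e ▸ sb 0) (rc 0) (rd 0)) (sc 0) (rc 0) (b₀ (sb 0)) (a₀ (ra 0))
  have b₁ : b 1 ≤ P := (lb 1).le_of_mem
    (fun e => four (pa 1) (pb 1) (pc 1) (e ▸ qd 0)) (pb 1) (qb 0) (c₁ (pc 1)) (a₀ (qa 0))
  have d₀ : d 0 ≤ P := (ld 0).le_of_mem
    (fun e => four (qa 0) (qb 0) (e ▸ sc 0) (qd 0)) (sd 0) (qd 0) (b₀ (sb 0)) (b₁ (qb 0))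
  have a₂ : a 2 ≤ P := (la 2).le_of_mem
    (fun e => four (qa 2) (qb 2) (e ▸ rc 2) (qd 2)) (qa 2) (ra 2) (b₀ (qb 2)) (d₀ (rd 2))
  have c₀ : c 0 ≤ P := (lc 0).le_of_mem
    (fun e => four (ra 2) (e ▸ pb 0) (rc 2) (rd 2)) (rc 2) (pc 0) (a₂ (ra 2)) (a₀ (pa 0))
  have b₂ : b 2 ≤ P := (lb 2).le_of_mem
    (fun e => four (pa 2) (pb 2) (pc 2) (e ▸ sd 2)) (pb 2) (sb 2) (a₂ (pa 2)) (c₀ (sc 2))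
  obtain ⟨x, hx, hxP⟩ := h.exists_not_le 1 hP
  rw [← h.range_eq hl.mem_b hl.inj_b] at hx
  obtain ⟨n, rfl⟩ := hx
  fin_cases n
  exacts [hxP b₀, hxP b₁, hxP b₂]

/-! ### Projective completions -/

section ProjCompletion

variable {l P Q : AffineSubspace ℝ Space} {p : Space}

/-- Homogeneous coordinates of an affine point. -/
def homPoint (x : Space) : HomSpace := (x, 1)

theorem homPoint_ne_zero (x : Space) : homPoint x ≠ 0 := fun h => one_ne_zero (congrArg Prod.snd h)

theorem homPoint_mem {x : Space} (hx : x ∈ l) : homPoint x ∈ projCompletion l :=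
  Submodule.subset_span ⟨x, hx, rfl⟩

/-- The linear map whose preimage of the direction is the projective completion. -/
def centerAt (p : Space) : HomSpace →ₗ[ℝ] Space :=
  LinearMap.fst ℝ Space ℝ - (LinearMap.snd ℝ Space ℝ).smulRight p

theorem centerAt_apply (p : Space) (x : HomSpace) : centerAt p x = x.1 - x.2 • p := rfl

/-- Homogeneous vectors split as a direction plus a multiple of the base point, so membership
becomes a linear condition on the direction alone. -/
theorem mem_projCompletion_iff (hp : p ∈ l) (x : HomSpace) :
    x ∈ projCompletion l ↔ centerAt p x ∈ l.direction := by
  constructor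
  · intro hx
    have : projCompletion l ≤ l.direction.comap (centerAt p) := by
      refine Submodule.span_le.2 ?_
      rintro _ ⟨y, hy, rfl⟩
      have := AffineSubspace.vsub_mem_direction hy hp
      simpa [centerAt_apply] using this
    exact this hx
  · intro hx
    have h1 : centerAt p x + p ∈ l := by
      have := AffineSubspace.vadd_mem_of_mem_direction hx hp
      simpa using this
    have h2 : x = homPoint (centerAt p x + p) + (x.2 - 1) • homPoint p := by
      ext
      · simp [homPoint, centerAt_apply, sub_mul]
      · simp [homPoint]
    rw [h2]
    exact add_mem (homPoint_mem h1) (Submodule.smul_mem _ _ (homPoint_mem hp))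

theorem homPoint_mem_iff (hl : (l : Set Space).Nonempty) {x : Space} :
    homPoint x ∈ projCompletion l ↔ x ∈ l := by
  refine ⟨fun h => ?_, homPoint_mem⟩
  obtain ⟨p, hp⟩ := hl
  rw [mem_projCompletion_iff hp] at h
  have := AffineSubspace.vadd_mem_of_mem_direction h hp
  simpa [centerAt_apply, homPoint] using this

theorem projCompletion_inf (hp : p ∈ P) (hq : p ∈ Q) :
    projCompletion (P ⊓ Q) = projCompletion P ⊓ projCompletion Q := by
  ext x
  rw [Submodule.mem_inf, mem_projCompletion_iff hp, mem_projCompletion_iff hq,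
    mem_projCompletion_iff (l := P ⊓ Q) ⟨hp, hq⟩, AffineSubspace.direction_inf_of_mem hp hq,
    Submodule.mem_inf]

/-- A line not contained in `P` that meets it in an affine point has no further common point with it
at infinity. -/
theorem IsLine.eq_smul_homPoint (hl : IsLine l) (hlP : ¬ l ≤ P) (hp : p ∈ l) (hp' : p ∈ P)
    {x : HomSpace} (hx : x ∈ projCompletion l) (hx' : x ∈ projCompletion P) :
    x = x.2 • homPoint p := by
  rw [mem_projCompletion_iff hp] at hx
  rw [mem_projCompletion_iff hp'] at hx'
  have h0 : centerAt p x = 0 := by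
    by_contra h
    refine hlP (hl.le_of_mem (p := centerAt p x + p) (q := p) (by simpa using h) ?_ hp ?_ hp')
    · simpa using AffineSubspace.vadd_mem_of_mem_direction hx hp
    · simpa using AffineSubspace.vadd_mem_of_mem_direction hx' hp'
  rw [centerAt_apply, sub_eq_zero] at h0
  ext
  · simp [h0, homPoint]
  · simp [homPoint]

theorem finrank_projCompletion (hp : p ∈ l) :
    Module.finrank ℝ (projCompletion l) = Module.finrank ℝ l.direction + 1 := by
  have hsurj : Function.Surjective (centerAt p) := fun x => ⟨(x, 0), by simp [centerAt_apply]⟩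
  have e : projCompletion l = l.direction.comap (centerAt p) := by
    ext x
    exact mem_projCompletion_iff hp x
  have h1 := LinearMap.finrank_range_add_finrank_ker ((centerAt p).domRestrict (projCompletion l))
  have hrange : LinearMap.range ((centerAt p).domRestrict (projCompletion l)) = l.direction := by
    rw [LinearMap.range_domRestrict, e, Submodule.map_comap_eq_of_surjective hsurj]
  have hker : Module.finrank ℝ (LinearMap.ker ((centerAt p).domRestrict (projCompletion l))) = 1 := by
    have hv : (⟨homPoint p, homPoint_mem hp⟩ : projCompletion l) ∈
        LinearMap.ker ((centerAt p).domRestrict (projCompletion l)) := by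
      simp [centerAt_apply, homPoint]
    refine finrank_eq_one (⟨_, hv⟩ : LinearMap.ker ((centerAt p).domRestrict (projCompletion l))) ?_ ?_
    · intro h
      exact homPoint_ne_zero p (congrArg Subtype.val (congrArg Subtype.val h))
    · rintro ⟨⟨x, hx⟩, hx'⟩
      refine ⟨x.2, ?_⟩
      have h0 : x.1 - x.2 • p = 0 := by simpa [centerAt_apply] using hx'
      rw [sub_eq_zero] at h0
      refine Subtype.ext (Subtype.ext ?_)
      ext
      · simp [h0, homPoint]
      · simp [homPoint]
  rw [hrange, hker] at h1
  exact h1.symm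

theorem finrank_homSpace : Module.finrank ℝ HomSpace = 4 := by
  simp [Module.finrank_prod]

theorem IsPlane.finrank_projCompletion (hP : IsPlane P) :
    Module.finrank ℝ (projCompletion P) = 3 := by
  obtain ⟨p, hp⟩ := hP.nonempty
  rw [_root_.finrank_projCompletion hp, hP]

theorem projCompletion_pair (p q : Space) :
    projCompletion line[ℝ, p, q] = Submodule.span ℝ {homPoint p, homPoint q} := by
  apply le_antisymm
  · refine Submodule.span_le.2 ?_
    rintro _ ⟨x, hx, rfl⟩
    obtain ⟨r, rfl⟩ := mem_affineSpan_pair_iff_exists_lineMap_eq.1 hx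
    refine Submodule.mem_span_pair.2 ⟨1 - r, r, ?_⟩
    ext
    · simp [homPoint, AffineMap.lineMap_apply]
      ring
    · simp [homPoint]
  · rw [Submodule.span_le]
    rintro _ (rfl | rfl)
    exacts [homPoint_mem (left_mem_affineSpan_pair ℝ p q),
      homPoint_mem (right_mem_affineSpan_pair ℝ p q)]

theorem IsLine.projCompletion_eq (hl : IsLine l) {q : Space} (hp : p ∈ l) (hq : q ∈ l)
    (hpq : p ≠ q) : projCompletion l = Submodule.span ℝ {homPoint p, homPoint q} := by
  rw [← projCompletion_pair, ← hl.eq_line hp hq hpq]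

end ProjCompletion

/-! ### General position -/

/-- Intersecting with one more plane, a hyperplane of the 4-dimensional space, lowers the dimension
by at most one. -/
theorem finrank_inf_le_add_card {Pl : Fin 6 → AffineSubspace ℝ Space} (hPl : ∀ i, IsPlane (Pl i))
    (t u : Finset (Fin 6)) :
    Module.finrank ℝ (t.inf fun i => projCompletion (Pl i) : Submodule ℝ HomSpace) ≤
      Module.finrank ℝ ((u ∪ t).inf fun i => projCompletion (Pl i) : Submodule ℝ HomSpace) + u.card := by
  induction u using Finset.induction_on with
  | empty =>
    rw [Finset.empty_union]
    exact Nat.le_add_right _ _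
  | insert i u hi ih =>
    rw [Finset.insert_union, Finset.inf_insert, Finset.card_insert_of_notMem hi]
    set A := (u ∪ t).inf fun i => projCompletion (Pl i)
    have h1 := Submodule.finrank_sup_add_finrank_inf_eq (projCompletion (Pl i)) A
    have h2 := Submodule.finrank_le (projCompletion (Pl i) ⊔ A)
    rw [finrank_homSpace] at h2
    have h3 := (hPl i).finrank_projCompletion
    omega

/-- Four planes bring the dimension from 4 down to 0 in steps of at most one, so every step is
exactly one. Hence the condition for fewer planes follows from that for four. -/
theorem inGeneralPosition_of_inf_eq_bot {Pl : Fin 6 → AffineSubspace ℝ Space}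
    (hPl : ∀ i, IsPlane (Pl i)) {s : Finset (Fin 6)} (hs : 4 ≤ s.card)
    (h : ∀ t ⊆ s, t.card = 4 → ∀ x, (∀ i ∈ t, x ∈ projCompletion (Pl i)) → x = 0) :
    InGeneralPosition Pl s := by
  intro t hts ht
  obtain ⟨t', htt', ht's, hcard⟩ := Finset.exists_subsuperset_card_eq hts ht hs
  have hbot : (t'.inf fun i => projCompletion (Pl i)) = ⊥ := by
    rw [eq_bot_iff]
    intro x hx
    rw [Submodule.mem_finsetInf] at hx
    exact h t' ht's hcard x hx
  have h1 := finrank_inf_le_add_card hPl t (t' \ t)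
  rw [Finset.sdiff_union_of_subset htt', hbot, finrank_bot, Finset.card_sdiff_of_subset htt',
    hcard] at h1
  have h2 := finrank_inf_le_add_card hPl ∅ t
  rw [Finset.union_empty, Finset.inf_empty, finrank_top, finrank_homSpace] at h2
  omega

/-- Four planes have no common point in projective space if the first two meet in a line which
the other two meet in different affine points. -/
theorem eq_zero_of_mem_four_planes {l P₁ P₂ P₃ P₄ : AffineSubspace ℝ Space} (hl : IsLine l)
    (hP₁ : IsPlane P₁) (hP₂ : IsPlane P₂) (hP₄ : IsPlane P₄) (h12 : P₁ ≠ P₂) (h₁ : l ≤ P₁)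
    (h₂ : l ≤ P₂) (h₃ : ¬ l ≤ P₃) {p : Space} (hp : p ∈ l) (hp₃ : p ∈ P₃) (hp₄ : p ∉ P₄)
    {x : HomSpace} (hx₁ : x ∈ projCompletion P₁) (hx₂ : x ∈ projCompletion P₂)
    (hx₃ : x ∈ projCompletion P₃) (hx₄ : x ∈ projCompletion P₄) : x = 0 := by
  have hxl : x ∈ projCompletion l := by
    rw [← hP₁.inf_eq hP₂ h12 hl h₁ h₂, projCompletion_inf (h₁ hp) (h₂ hp)]
    exact ⟨hx₁, hx₂⟩
  have hx := hl.eq_smul_homPoint h₃ hp hp₃ hxl hx₃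
  by_cases h0 : x.2 = 0
  · rw [hx, h0, zero_smul]
  · rw [hx, Submodule.smul_mem_iff _ h0, homPoint_mem_iff hP₄.nonempty] at hx₄
    exact absurd hx₄ hp₄

/-! ### Desargues-type configurations -/

/-- Lines `c i` (of color `0`) and `m i j` (of color `1 + (j - i)`) with the incidences of a
Desargues-type configuration: `c i` and the lines `m u j`, `u ≠ i`, meet in `X i j`, and the lines
`m i j` with fixed `i` meet in `Y i`. -/
structure IsDesarguesLabelling (L : Fin 4 → Set (AffineSubspace ℝ Space))
    (c : Fin 3 → AffineSubspace ℝ Space) (m : Fin 3 → Fin 3 → AffineSubspace ℝ Space)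
    (X : Fin 3 → Fin 3 → Space) (Y : Fin 3 → Space) : Prop where
  range_c : Set.range c = L 0
  range_m : ∀ k : Fin 3, Set.range (fun i => m i (i + k)) = L k.succ
  X_c : ∀ i j, X i j ∈ c i
  X_m : ∀ i j u, u ≠ i → X i j ∈ m u j
  Y_m : ∀ i j, Y i ∈ m i j

namespace IsDesarguesLabelling

variable {L : Fin 4 → Set (AffineSubspace ℝ Space)} {c : Fin 3 → AffineSubspace ℝ Space}
  {m : Fin 3 → Fin 3 → AffineSubspace ℝ Space} {X : Fin 3 → Fin 3 → Space} {Y : Fin 3 → Space}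

theorem mem_c (hd : IsDesarguesLabelling L c m X Y) (i : Fin 3) : c i ∈ L 0 :=
  hd.range_c ▸ Set.mem_range_self i

theorem mem_m (hd : IsDesarguesLabelling L c m X Y) (i j : Fin 3) : m i j ∈ L (j - i).succ := by
  rw [← hd.range_m]
  exact ⟨i, by simp⟩

theorem isLine_c (hd : IsDesarguesLabelling L c m X Y) (h : IsAdmissible L) (i : Fin 3) :
    IsLine (c i) := h.isLine _ _ (hd.mem_c i)

theorem isLine_m (hd : IsDesarguesLabelling L c m X Y) (h : IsAdmissible L) (i j : Fin 3) :
    IsLine (m i j) := h.isLine _ _ (hd.mem_m i j)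

theorem m_ne (hd : IsDesarguesLabelling L c m X Y) (h : IsAdmissible L) {i j i' j' : Fin 3}
    (hne : j - i ≠ j' - i') : m i j ≠ m i' j' :=
  h.disjoint (by simpa using hne) (hd.mem_m i j) (hd.mem_m i' j')

/-- The point `X i j` is the incidence omitting the color of `m i j`: the line `c i` and the two
lines `m u j` with `u ≠ i` provide the other three. This is the source of all distinctness
statements for the points. -/
theorem X_notMem_m (hd : IsDesarguesLabelling L c m X Y) (h : IsAdmissible L) {i j u v : Fin 3}
    (huv : v - u = j - i) : X i j ∉ m u v := by
  intro hX
  have e : ∀ k : Fin 4, k = 0 ∨ k = (v - u).succ ∨ k = (j - (i + 1)).succ ∨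
      k = (j - (i + 2)).succ := by
    rw [huv]
    clear * -
    revert i j
    decide
  exact h.false_of_mem_four e (hd.mem_c i) (hd.mem_m u v) (hd.mem_m (i + 1) j)
    (hd.mem_m (i + 2) j) (hd.X_c i j) hX (hd.X_m i j _ (by simp)) (hd.X_m i j _ (by simp))

theorem X_ne_Y (hd : IsDesarguesLabelling L c m X Y) (h : IsAdmissible L) (i j u : Fin 3) :
    X i j ≠ Y u := by
  intro e
  refine hd.X_notMem_m h (i := i) (j := j) (u := u) (v := u + (j - i)) (by simp) ?_
  rw [e]
  exact hd.Y_m _ _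

theorem X_ne_of_right_ne (hd : IsDesarguesLabelling L c m X Y) (h : IsAdmissible L)
    {i j j' : Fin 3} (hj : j ≠ j') : X i j ≠ X i j' := by
  intro e
  have h₁ : i + (j' - j) ≠ i := by simpa [sub_eq_zero] using hj.symm
  refine hd.X_notMem_m h (i := i) (j := j) (u := i + (j' - j)) (v := j') (by abel) ?_
  rw [e]
  exact hd.X_m i j' _ h₁

theorem X_ne_of_left_ne (hd : IsDesarguesLabelling L c m X Y) (h : IsAdmissible L)
    {i i' j : Fin 3} (hi : i ≠ i') : X i j ≠ X i' j := by
  intro e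
  refine hd.X_notMem_m h (i := i) (j := j) (u := i) (v := j) rfl ?_
  rw [e]
  exact hd.X_m i' j _ hi

theorem exists_third (i j : Fin 3) : ∃ k, k ≠ i ∧ k ≠ j := by
  revert i j
  decide

/-- The planes of a Desargues-type configuration with the given labels. -/
structure IsPlanes (c : Fin 3 → AffineSubspace ℝ Space)
    (m : Fin 3 → Fin 3 → AffineSubspace ℝ Space) (P Q : Fin 3 → AffineSubspace ℝ Space) :
    Prop where
  isPlane_P : ∀ i, IsPlane (P i)
  isPlane_Q : ∀ i, IsPlane (Q i)
  m_le_P : ∀ i j, m i j ≤ P i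
  m_le_Q : ∀ i j, m i j ≤ Q j
  c_le_P : ∀ i i', i' ≠ i → c i' ≤ P i

/-- The lines `m i j` with fixed `i` pass through `Y i`, and each `c i'` with `i' ≠ i` crosses all
of them, so they share a plane. The lines `m i j` with fixed `j` meet pairwise in the three points
`X u j`, so they form a triangle. -/
theorem exists_planes (hd : IsDesarguesLabelling L c m X Y) (h : IsAdmissible L) :
    ∃ P Q : Fin 3 → AffineSubspace ℝ Space, IsPlanes c m P Q := by
  have hP : ∀ i, ∃ P, IsPlane P ∧ (∀ j, m i j ≤ P) ∧ ∀ i', i' ≠ i → c i' ≤ P := by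
    intro i
    obtain ⟨P, hP, h0, h1⟩ := exists_isPlane_of_lines (hd.isLine_m h i 0) (hd.isLine_m h i 1)
      (hd.m_ne h (by clear * -; revert i; decide)) (hd.Y_m i 0) (hd.Y_m i 1)
    have hc : ∀ i', i' ≠ i → c i' ≤ P := fun i' hi' =>
      (hd.isLine_c h i').le_of_mem (hd.X_ne_of_right_ne h (by decide)) (hd.X_c i' 0) (hd.X_c i' 1)
        (h0 (hd.X_m i' 0 i hi'.symm)) (h1 (hd.X_m i' 1 i hi'.symm))
    refine ⟨P, hP, fun j => ?_, hc⟩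
    obtain ⟨i', hi', -⟩ := exists_third i i
    exact (hd.isLine_m h i j).le_of_mem (hd.X_ne_Y h i' j i) (hd.X_m i' j i hi'.symm) (hd.Y_m i j)
      (hc i' hi' (hd.X_c i' j)) (h0 (hd.Y_m i 0))
  have hQ : ∀ j, ∃ Q, IsPlane Q ∧ ∀ i, m i j ≤ Q := by
    intro j
    obtain ⟨Q, hQ, h0, h1⟩ := exists_isPlane_of_lines (hd.isLine_m h 0 j) (hd.isLine_m h 1 j)
      (hd.m_ne h (by clear * -; revert j; decide)) (hd.X_m 2 j 0 (by decide)) (hd.X_m 2 j 1 (by decide))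
    have h2 : m 2 j ≤ Q := (hd.isLine_m h 2 j).le_of_mem
      (hd.X_ne_of_left_ne h (i := 0) (i' := 1) (by decide)) (hd.X_m 0 j 2 (by decide))
      (hd.X_m 1 j 2 (by decide)) (h1 (hd.X_m 0 j 1 (by decide))) (h0 (hd.X_m 1 j 0 (by decide)))
    refine ⟨Q, hQ, fun i => ?_⟩
    fin_cases i
    exacts [h0, h1, h2]
  choose P hP₁ hP₂ hP₃ using hP
  choose Q hQ₁ hQ₂ using hQ
  exact ⟨P, Q, hP₁, hQ₁, hP₂, fun i j => hQ₂ j i, hP₃⟩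

section Planes

variable {P Q : Fin 3 → AffineSubspace ℝ Space}

theorem exists_c_not_le (hd : IsDesarguesLabelling L c m X Y) (h : IsAdmissible L)
    {R : AffineSubspace ℝ Space} (hR : IsPlane R) : ∃ i, ¬ c i ≤ R := by
  obtain ⟨x, hx, hxR⟩ := h.exists_not_le 0 hR
  rw [← hd.range_c] at hx
  obtain ⟨i, rfl⟩ := hx
  exact ⟨i, hxR⟩

theorem c_not_le_P (hd : IsDesarguesLabelling L c m X Y) (h : IsAdmissible L)
    (hp : IsPlanes c m P Q) (i : Fin 3) : ¬ c i ≤ P i := by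
  intro hi
  obtain ⟨i', hi'⟩ := hd.exists_c_not_le h (hp.isPlane_P i)
  by_cases e : i' = i
  · exact hi' (e ▸ hi)
  · exact hi' (hp.c_le_P i i' e)

/-- Otherwise all lines `m u j` would lie in `P i`, joining `Y u` to points of the third line of
color 0. They cross `c i` in several points, so `c i` would follow, and with it the whole color
class. -/
theorem Y_notMem_P (hd : IsDesarguesLabelling L c m X Y) (h : IsAdmissible L)
    (hp : IsPlanes c m P Q) {i u : Fin 3} (hu : u ≠ i) : Y u ∉ P i := by
  intro hY
  obtain ⟨w, hwi, hwu⟩ := exists_third i u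
  have hm : ∀ j, m u j ≤ P i := fun j =>
    (hd.isLine_m h u j).le_of_mem (hd.X_ne_Y h w j u) (hd.X_m w j u hwu.symm) (hd.Y_m u j)
      (hp.c_le_P i w hwi (hd.X_c w j)) hY
  exact hd.c_not_le_P h hp i ((hd.isLine_c h i).le_of_mem
    (hd.X_ne_of_right_ne h (j := 0) (j' := 1) (by decide)) (hd.X_c i 0) (hd.X_c i 1)
    (hm 0 (hd.X_m i 0 u hu)) (hm 1 (hd.X_m i 1 u hu)))

/-- Otherwise the lines `m w j'` joining `Y w` to the points of `c i` lie in `Q j`, and with them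
every other line of color 0 that they cross. -/
theorem c_not_le_Q (hd : IsDesarguesLabelling L c m X Y) (h : IsAdmissible L)
    (hp : IsPlanes c m P Q) (i j : Fin 3) : ¬ c i ≤ Q j := by
  intro hi
  obtain ⟨u, hu⟩ := hd.exists_c_not_le h (hp.isPlane_Q j)
  obtain ⟨w, hwi, hwu⟩ := exists_third i u
  have hm : ∀ j', m w j' ≤ Q j := fun j' =>
    (hd.isLine_m h w j').le_of_mem (hd.X_ne_Y h i j' w) (hd.X_m i j' w hwi) (hd.Y_m w j')
      (hi (hd.X_c i j')) (hp.m_le_Q w j (hd.Y_m w j))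
  exact hu ((hd.isLine_c h u).le_of_mem
    (hd.X_ne_of_right_ne h (j := 0) (j' := 1) (by decide)) (hd.X_c u 0) (hd.X_c u 1)
    (hm 0 (hd.X_m u 0 w hwu)) (hm 1 (hd.X_m u 1 w hwu)))

theorem X_notMem_P (hd : IsDesarguesLabelling L c m X Y) (h : IsAdmissible L)
    (hp : IsPlanes c m P Q) (i j : Fin 3) : X i j ∉ P i := by
  intro hX
  obtain ⟨u, hu, -⟩ := exists_third i i
  obtain ⟨w, hwi, hwu⟩ := exists_third i u
  refine hd.Y_notMem_P h hp hu ((hd.isLine_m h u j).le_of_mem (hd.X_ne_of_left_ne h hwi.symm)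
    (hd.X_m i j u hu) (hd.X_m w j u hwu.symm) hX (hp.c_le_P i w hwi (hd.X_c w j)) (hd.Y_m u j))

theorem X_mem_Q (hd : IsDesarguesLabelling L c m X Y) (hp : IsPlanes c m P Q) (i j : Fin 3) :
    X i j ∈ Q j := by
  obtain ⟨u, hu, -⟩ := exists_third i i
  exact hp.m_le_Q u j (hd.X_m i j u hu)

theorem X_notMem_Q (hd : IsDesarguesLabelling L c m X Y) (h : IsAdmissible L)
    (hp : IsPlanes c m P Q) (i : Fin 3) {j j' : Fin 3} (hj : j ≠ j') : X i j ∉ Q j' :=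
  fun hX => hd.c_not_le_Q h hp i j' ((hd.isLine_c h i).le_of_mem (hd.X_ne_of_right_ne h hj)
    (hd.X_c i j) (hd.X_c i j') hX (hd.X_mem_Q hp i j'))

theorem c_le_P_iff (hd : IsDesarguesLabelling L c m X Y) (h : IsAdmissible L)
    (hp : IsPlanes c m P Q) (i i' : Fin 3) : c i ≤ P i' ↔ i ≠ i' :=
  ⟨fun hle e => hd.c_not_le_P h hp i' (e ▸ hle), hp.c_le_P i' i⟩

theorem m_le_P_iff (hd : IsDesarguesLabelling L c m X Y) (h : IsAdmissible L)
    (hp : IsPlanes c m P Q) (i j i' : Fin 3) : m i j ≤ P i' ↔ i = i' := by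
  refine ⟨fun hle => ?_, fun e => e ▸ hp.m_le_P i j⟩
  by_contra e
  exact hd.Y_notMem_P h hp e (hle (hd.Y_m i j))

theorem m_le_Q_iff (hd : IsDesarguesLabelling L c m X Y) (h : IsAdmissible L)
    (hp : IsPlanes c m P Q) (i j j' : Fin 3) : m i j ≤ Q j' ↔ j = j' := by
  refine ⟨fun hle => ?_, fun e => e ▸ hp.m_le_Q i j⟩
  by_contra e
  obtain ⟨u, hu, -⟩ := exists_third i i
  exact hd.X_notMem_Q h hp u e (hle (hd.X_m u j i hu.symm))

theorem P_ne (hd : IsDesarguesLabelling L c m X Y) (h : IsAdmissible L)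
    (hp : IsPlanes c m P Q) {i i' : Fin 3} (hi : i ≠ i') : P i ≠ P i' := fun e =>
  hd.c_not_le_P h hp i (e ▸ hp.c_le_P i' i hi)

theorem P_ne_Q (hd : IsDesarguesLabelling L c m X Y) (h : IsAdmissible L)
    (hp : IsPlanes c m P Q) (i j : Fin 3) : P i ≠ Q j := by
  intro e
  obtain ⟨u, hu, -⟩ := exists_third i i
  exact hd.c_not_le_Q h hp u j (e ▸ hp.c_le_P i u hu)

theorem Q_ne (hd : IsDesarguesLabelling L c m X Y) (h : IsAdmissible L)
    (hp : IsPlanes c m P Q) {j j' : Fin 3} (hj : j ≠ j') : Q j ≠ Q j' := fun e =>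
  hd.X_notMem_Q h hp 0 hj (e ▸ hd.X_mem_Q hp 0 j)

theorem P_inf_P (hd : IsDesarguesLabelling L c m X Y) (h : IsAdmissible L)
    (hp : IsPlanes c m P Q) {i i' u : Fin 3} (hi : i ≠ i') (hui : u ≠ i) (hui' : u ≠ i') :
    P i ⊓ P i' = c u :=
  (hp.isPlane_P i).inf_eq (hp.isPlane_P i') (hd.P_ne h hp hi) (hd.isLine_c h u)
    (hp.c_le_P i u hui) (hp.c_le_P i' u hui')

theorem P_inf_Q (hd : IsDesarguesLabelling L c m X Y) (h : IsAdmissible L)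
    (hp : IsPlanes c m P Q) (i j : Fin 3) : P i ⊓ Q j = m i j :=
  (hp.isPlane_P i).inf_eq (hp.isPlane_Q j) (hd.P_ne_Q h hp i j) (hd.isLine_m h i j)
    (hp.m_le_P i j) (hp.m_le_Q i j)

/-- The axis joins `Y 0` to `Y 1`: every plane `Q j` contains both points, through `m 0 j` and `m 1
j`. -/
theorem exists_axis (hd : IsDesarguesLabelling L c m X Y) (h : IsAdmissible L)
    (hp : IsPlanes c m P Q) : ∃ l, IsLine l ∧ ∀ j j', j ≠ j' → Q j ⊓ Q j' = l := by
  have hY : Y 0 ≠ Y 1 := fun e =>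
    hd.Y_notMem_P h hp (i := 1) (u := 0) (by decide) (e ▸ hp.m_le_P 1 0 (hd.Y_m 1 0))
  have hl : IsLine line[ℝ, Y 0, Y 1] := by
    unfold IsLine
    rw [direction_affineSpan, vectorSpan_pair]
    exact finrank_span_singleton (by simpa [sub_eq_zero] using hY)
  have hle : ∀ j, line[ℝ, Y 0, Y 1] ≤ Q j := fun j => affineSpan_pair_le_of_mem_of_mem
    (hp.m_le_Q 0 j (hd.Y_m 0 j)) (hp.m_le_Q 1 j (hd.Y_m 1 j))
  exact ⟨_, hl, fun j j' hj => (hp.isPlane_Q j).inf_eq (hp.isPlane_Q j') (hd.Q_ne h hp hj) hl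
    (hle j) (hle j')⟩

/-- The six planes of a Desargues-type configuration. -/
def planes (P Q : Fin 3 → AffineSubspace ℝ Space) : Fin 6 → AffineSubspace ℝ Space :=
  ![P 0, P 1, P 2, Q 0, Q 1, Q 2]

theorem fin_six_cases (n : Fin 6) :
    (∃ i : Fin 3, n = i.castAdd 3) ∨ ∃ i : Fin 3, n = i.natAdd 3 := by
  revert n
  decide

theorem planes_castAdd (i : Fin 3) : planes P Q (i.castAdd 3) = P i := by
  fin_cases i <;> rfl

theorem planes_natAdd (i : Fin 3) : planes P Q (i.natAdd 3) = Q i := by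
  fin_cases i <;> rfl

theorem isPlane_planes (hp : IsPlanes c m P Q) (n : Fin 6) : IsPlane (planes P Q n) := by
  obtain ⟨i, rfl⟩ | ⟨i, rfl⟩ := fin_six_cases n
  · rw [planes_castAdd]
    exact hp.isPlane_P i
  · rw [planes_natAdd]
    exact hp.isPlane_Q i

theorem planes_injective (hd : IsDesarguesLabelling L c m X Y) (h : IsAdmissible L)
    (hp : IsPlanes c m P Q) : Function.Injective (planes P Q) := by
  intro n n'
  obtain ⟨i, rfl⟩ | ⟨i, rfl⟩ := fin_six_cases n <;>
    obtain ⟨i', rfl⟩ | ⟨i', rfl⟩ := fin_six_cases n' <;>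
    simp only [planes_castAdd, planes_natAdd] <;> intro e
  · by_contra hne
    exact hd.P_ne h hp (fun hi => hne (by rw [hi])) e
  · exact absurd e (hd.P_ne_Q h hp _ _)
  · exact absurd e.symm (hd.P_ne_Q h hp _ _)
  · by_contra hne
    exact hd.Q_ne h hp (fun hi => hne (by rw [hi])) e

theorem eq_zero_of_mem_P (hd : IsDesarguesLabelling L c m X Y) (h : IsAdmissible L)
    (hp : IsPlanes c m P Q) {x : HomSpace} (hx : ∀ i, x ∈ projCompletion (P i)) (j : Fin 3)
    (hx' : x ∈ projCompletion (Q j)) : x = 0 :=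
  eq_zero_of_mem_four_planes (hd.isLine_c h 0) (hp.isPlane_P 1) (hp.isPlane_P 2)
    (hp.isPlane_P 0) (hd.P_ne h hp (by decide)) (hp.c_le_P 1 0 (by decide))
    (hp.c_le_P 2 0 (by decide)) (hd.c_not_le_Q h hp 0 j) (hd.X_c 0 j) (hd.X_mem_Q hp 0 j)
    (hd.X_notMem_P h hp 0 j) (hx 1) (hx 2) hx' (hx 0)

theorem eq_zero_of_mem_Q (hd : IsDesarguesLabelling L c m X Y) (h : IsAdmissible L)
    (hp : IsPlanes c m P Q) {x : HomSpace} {i i' j j' : Fin 3} (hi : i ≠ i') (hj : j ≠ j')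
    (hx₁ : x ∈ projCompletion (P i)) (hx₂ : x ∈ projCompletion (P i'))
    (hx₃ : x ∈ projCompletion (Q j)) (hx₄ : x ∈ projCompletion (Q j')) : x = 0 := by
  obtain ⟨u, hui, hui'⟩ := exists_third i i'
  exact eq_zero_of_mem_four_planes (hd.isLine_c h u) (hp.isPlane_P i) (hp.isPlane_P i')
    (hp.isPlane_Q j') (hd.P_ne h hp hi) (hp.c_le_P i u hui) (hp.c_le_P i' u hui')
    (hd.c_not_le_Q h hp u j) (hd.X_c u j) (hd.X_mem_Q hp u j) (hd.X_notMem_Q h hp u hj)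
    hx₁ hx₂ hx₃ hx₄

theorem inGeneralPosition_five (hd : IsDesarguesLabelling L c m X Y) (h : IsAdmissible L)
    (hp : IsPlanes c m P Q) : InGeneralPosition (planes P Q) {0, 1, 2, 3, 4} := by
  refine inGeneralPosition_of_inf_eq_bot (isPlane_planes hp) (by decide) fun t ht htc x hx => ?_
  have key : ∀ t ⊆ ({0, 1, 2, 3, 4} : Finset (Fin 6)), t.card = 4 →
      ({0, 1, 2, 3} : Finset (Fin 6)) ⊆ t ∨ ({0, 1, 2, 4} : Finset (Fin 6)) ⊆ t ∨
      ({0, 1, 3, 4} : Finset (Fin 6)) ⊆ t ∨ ({0, 2, 3, 4} : Finset (Fin 6)) ⊆ t ∨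
      ({1, 2, 3, 4} : Finset (Fin 6)) ⊆ t := by decide
  have hxP (i : Fin 3) (hi : i.castAdd 3 ∈ t) : x ∈ projCompletion (P i) :=
    planes_castAdd (P := P) (Q := Q) i ▸ hx _ hi
  have hxQ (i : Fin 3) (hi : i.natAdd 3 ∈ t) : x ∈ projCompletion (Q i) :=
    planes_natAdd (P := P) (Q := Q) i ▸ hx _ hi
  rcases key t ht htc with ht | ht | ht | ht | ht
  · refine hd.eq_zero_of_mem_P h hp (fun i => hxP i (ht ?_)) 0 (hxQ 0 (ht (by decide)))
    revert i
    decide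
  · refine hd.eq_zero_of_mem_P h hp (fun i => hxP i (ht ?_)) 1 (hxQ 1 (ht (by decide)))
    revert i
    decide
  · exact hd.eq_zero_of_mem_Q h hp (i := 0) (i' := 1) (j := 0) (j' := 1) (by decide) (by decide)
      (hxP 0 (ht (by decide))) (hxP 1 (ht (by decide))) (hxQ 0 (ht (by decide)))
      (hxQ 1 (ht (by decide)))
  · exact hd.eq_zero_of_mem_Q h hp (i := 0) (i' := 2) (j := 0) (j' := 1) (by decide) (by decide)
      (hxP 0 (ht (by decide))) (hxP 2 (ht (by decide))) (hxQ 0 (ht (by decide)))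
      (hxQ 1 (ht (by decide)))
  · exact hd.eq_zero_of_mem_Q h hp (i := 1) (i' := 2) (j := 0) (j' := 1) (by decide) (by decide)
      (hxP 1 (ht (by decide))) (hxP 2 (ht (by decide))) (hxQ 0 (ht (by decide)))
      (hxQ 1 (ht (by decide)))

theorem inGeneralPosition_four (hd : IsDesarguesLabelling L c m X Y) (h : IsAdmissible L)
    (hp : IsPlanes c m P Q) : InGeneralPosition (planes P Q) {0, 1, 2, 5} := by
  refine inGeneralPosition_of_inf_eq_bot (isPlane_planes hp) (by decide) fun t ht htc x hx => ?_
  obtain rfl := Finset.eq_of_subset_of_card_le ht (by rw [htc]; decide)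
  refine hd.eq_zero_of_mem_P h hp (fun i => ?_) 2 (hx 5 (by decide))
  rw [← planes_castAdd (P := P) (Q := Q)]
  refine hx _ ?_
  clear * -
  revert i
  decide

theorem setOf_le_planes (hd : IsDesarguesLabelling L c m X Y) (h : IsAdmissible L)
    (hp : IsPlanes c m P Q) :
    {l | IsLine l ∧ {n | l ≤ planes P Q n}.ncard = 2} =
      {l | (∃ i, c i = l) ∨ ∃ i j, m i j = l} := by
  obtain ⟨ax, hax, haxQ⟩ := hd.exists_axis h hp
  have haxle : ∀ j, ax ≤ Q j := fun j => by
    obtain ⟨j', hj', -⟩ := exists_third j j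
    exact haxQ j j' hj'.symm ▸ inf_le_left
  ext l
  constructor
  · rintro ⟨hl, hcard⟩
    obtain ⟨n, n', hne, hset⟩ := Set.ncard_eq_two.1 hcard
    have hn : n ∈ {n | l ≤ planes P Q n} := hset.symm ▸ Set.mem_insert n {n'}
    have hn' : n' ∈ {n | l ≤ planes P Q n} := hset.symm ▸ Set.mem_insert_of_mem n rfl
    rw [Set.mem_ofPred_eq] at hn hn'
    have hmem : ∀ k, l ≤ planes P Q k → k = n ∨ k = n' := fun k hk => by
      have : k ∈ {n | l ≤ planes P Q n} := hk
      simpa [hset] using this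
    clear hset hcard
    have heq : planes P Q n ⊓ planes P Q n' = l :=
      (isPlane_planes hp n).inf_eq (isPlane_planes hp n')
        (fun e => hne (hd.planes_injective h hp e)) hl hn hn'
    revert hne hn hn' hmem heq
    obtain ⟨i, rfl⟩ | ⟨i, rfl⟩ := fin_six_cases n <;>
      obtain ⟨i', rfl⟩ | ⟨i', rfl⟩ := fin_six_cases n' <;>
      simp only [planes_castAdd, planes_natAdd] <;> intro hne hn hn' hmem heq
    · obtain ⟨u, hui, hui'⟩ := exists_third i i'
      exact Or.inl ⟨u, by rw [← heq, hd.P_inf_P h hp (fun e => hne (by rw [e])) hui hui']⟩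
    · exact Or.inr ⟨i, i', by rw [← heq, hd.P_inf_Q h hp]⟩
    · exact Or.inr ⟨i', i, by rw [← heq, inf_comm, hd.P_inf_Q h hp]⟩
    -- Two planes `Q` meet in the axis, which also lies in the third one and is therefore not
    -- counted.
    · exfalso
      rw [haxQ i i' (fun e => hne (by rw [e]))] at heq
      subst heq
      obtain ⟨u, hui, hui'⟩ := exists_third i i'
      rcases hmem (u.natAdd 3) (by rw [planes_natAdd]; exact haxle u) with e | e
      · exact hui (by simpa [Fin.ext_iff] using e)
      · exact hui' (by simpa [Fin.ext_iff] using e)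
  · rintro (⟨i, rfl⟩ | ⟨i, j, rfl⟩)
    · refine ⟨hd.isLine_c h i, Set.ncard_eq_two.2
        ⟨(i + 1).castAdd 3, (i + 2).castAdd 3, by clear * -; revert i; decide, ?_⟩⟩
      ext n
      obtain ⟨i', rfl⟩ | ⟨i', rfl⟩ := fin_six_cases n
      · simp only [Set.mem_ofPred_eq, planes_castAdd, hd.c_le_P_iff h hp]
        clear * -
        revert i i'
        decide
      · simp only [Set.mem_ofPred_eq, planes_natAdd, hd.c_not_le_Q h hp]
        clear * -
        revert i i'
        decide
    · refine ⟨hd.isLine_m h i j, Set.ncard_eq_two.2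
        ⟨i.castAdd 3, j.natAdd 3, by clear * -; revert i j; decide, ?_⟩⟩
      ext n
      obtain ⟨i', rfl⟩ | ⟨i', rfl⟩ := fin_six_cases n
      · simp only [Set.mem_ofPred_eq, planes_castAdd, hd.m_le_P_iff h hp]
        clear * -
        revert i j i'
        decide
      · simp only [Set.mem_ofPred_eq, planes_natAdd, hd.m_le_Q_iff h hp]
        clear * -
        revert i j i'
        decide

end Planes

theorem iUnion_eq (hd : IsDesarguesLabelling L c m X Y) :
    ⋃ i, L i = {l | (∃ i, c i = l) ∨ ∃ i j, m i j = l} := by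
  ext l
  constructor
  · intro hl
    obtain ⟨k, hk⟩ := Set.mem_iUnion.1 hl
    revert hk
    refine Fin.cases ?_ (fun k => ?_) k <;> intro hk
    · rw [← hd.range_c] at hk
      exact Or.inl hk
    · rw [← hd.range_m] at hk
      obtain ⟨i, rfl⟩ := hk
      exact Or.inr ⟨i, _, rfl⟩
  · rintro (⟨i, rfl⟩ | ⟨i, j, rfl⟩)
    · exact Set.mem_iUnion.2 ⟨0, hd.mem_c i⟩
    · exact Set.mem_iUnion.2 ⟨_, hd.mem_m i j⟩

theorem range_fin_three (f : Fin 3 → AffineSubspace ℝ Space) :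
    Set.range f = {f 0, f 1, f 2} := by
  ext x
  simp [Fin.exists_fin_succ, eq_comm]

theorem eq_desarguesColoring (hd : IsDesarguesLabelling L c m X Y) (h : IsAdmissible L)
    {P Q : Fin 3 → AffineSubspace ℝ Space} (hp : IsPlanes c m P Q) (i : Fin 4) :
    L i = desarguesColoring (planes P Q) i := by
  have e (i j : Fin 3) : m i j = planes P Q (i.castAdd 3) ⊓ planes P Q (j.natAdd 3) := by
    rw [planes_castAdd, planes_natAdd, hd.P_inf_Q h hp]
  have e' (i i' u : Fin 3) (hi : i ≠ i') (hui : u ≠ i) (hui' : u ≠ i') :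
      c u = planes P Q (i.castAdd 3) ⊓ planes P Q (i'.castAdd 3) := by
    rw [planes_castAdd, planes_castAdd, hd.P_inf_P h hp hi hui hui']
  refine Fin.cases ?_ (fun k => ?_) i
  · have hset : ({c 0, c 1, c 2} : Set (AffineSubspace ℝ Space)) = {c 2, c 1, c 0} := by
      ext x
      simp only [Set.mem_insert_iff, Set.mem_singleton_iff]
      tauto
    rw [← hd.range_c, range_fin_three, hset, e' 1 2 0 (by decide) (by decide) (by decide),
      e' 0 2 1 (by decide) (by decide) (by decide), e' 0 1 2 (by decide) (by decide) (by decide)]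
    rfl
  · rw [← hd.range_m, range_fin_three, e, e, e]
    fin_cases k <;> rfl

theorem isColoredDesarguesType (hd : IsDesarguesLabelling L c m X Y) (h : IsAdmissible L) :
    IsColoredDesarguesType L := by
  obtain ⟨P, Q, hp⟩ := hd.exists_planes h
  obtain ⟨ax, hax, haxQ⟩ := hd.exists_axis h hp
  refine ⟨planes P Q, ⟨isPlane_planes hp, hd.planes_injective h hp, hd.inGeneralPosition_five h hp,
    hd.inGeneralPosition_four h hp, ?_, ?_⟩, Equiv.refl _, hd.eq_desarguesColoring h hp⟩
  · have e : Q 0 ⊓ Q 1 ⊓ Q 2 = ax := by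
      rw [haxQ 0 1 (by decide), inf_eq_left, ← haxQ 1 2 (by decide)]
      exact inf_le_right
    exact e ▸ hax
  · rw [hd.setOf_le_planes h hp, hd.iUnion_eq]

end IsDesarguesLabelling

theorem IsColoredDesarguesType.of_perm {L : Fin 4 → Set (AffineSubspace ℝ Space)}
    (σ : Equiv.Perm (Fin 4)) (h : IsColoredDesarguesType fun i => L (σ i)) :
    IsColoredDesarguesType L := by
  obtain ⟨Pl, hPl, τ, hτ⟩ := h
  exact ⟨Pl, by rwa [σ.surjective.iUnion_comp] at hPl, τ.trans σ, hτ⟩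

/-- The lines through `Y i` are those of the incidence of the colors 1, 2, 3 with index `2 - i`, so
the shifts `2` and `0` explain the labels `2 - i`, `1 - i`, `2 - i`. The lines of color 0 are
numbered backwards, and `X i j` is the incidence omitting the color `1 + (j - i)`. -/
theorem IsCyclicLabelling.exists_isDesarguesLabelling {L : Fin 4 → Set (AffineSubspace ℝ Space)}
    {a b c d : Fin 3 → AffineSubspace ℝ Space} (h : IsAdmissible L)
    (hl : IsCyclicLabelling L a b c d 2 1 2 0) :
    ∃ c' m X Y, IsDesarguesLabelling L c' m X Y := by
  set m : Fin 3 → Fin 3 → AffineSubspace ℝ Space :=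
    fun i j => (![b (2 - i), c (1 - i), d (2 - i)] : Fin 3 → AffineSubspace ℝ Space) (j - i) with hm
  choose p pa pb pc using hl.abc
  choose q qa qb qd using hl.abd
  choose r ra rc rd using hl.acd
  choose s sb sc sd using hl.bcd
  have hb : ∀ {x u v} n, x ∈ b n → v - u = 0 → n = 2 - u → x ∈ m u v := by
    rintro x u v _ hx huv rfl
    simp only [hm, huv]
    exact hx
  have hc : ∀ {x u v} n, x ∈ c n → v - u = 1 → n = 1 - u → x ∈ m u v := by
    rintro x u v _ hx huv rfl
    simp only [hm, huv]
    exact hx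
  have hd : ∀ {x u v} n, x ∈ d n → v - u = 2 → n = 2 - u → x ∈ m u v := by
    rintro x u v _ hx huv rfl
    simp only [hm, huv]
    exact hx
  have hX : ∀ i j, ∃ x, x ∈ a (-i) ∧ ∀ u, u ≠ i → x ∈ m u j := by
    intro i j
    obtain rfl | rfl | rfl : j = i ∨ j = i + 1 ∨ j = i + 2 := by
      clear * -
      revert i j
      decide
    · refine ⟨r (-j), ra _, fun u hu => ?_⟩
      fin_cases j <;> fin_cases u <;>
        first
        | exact absurd rfl hu
        | exact hc _ (rc _) (by decide) (by decide)
        | exact hd _ (rd _) (by decide) (by decide)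
    · refine ⟨q (-i), qa _, fun u hu => ?_⟩
      fin_cases i <;> fin_cases u <;>
        first
        | exact absurd rfl hu
        | exact hb _ (qb _) (by decide) (by decide)
        | exact hd _ (qd _) (by decide) (by decide)
    · refine ⟨p (-i), pa _, fun u hu => ?_⟩
      fin_cases i <;> fin_cases u <;>
        first
        | exact absurd rfl hu
        | exact hb _ (pb _) (by decide) (by decide)
        | exact hc _ (pc _) (by decide) (by decide)
  choose X hXc hXm using hX
  refine ⟨fun i => a (-i), m, X, fun i => s (2 - i), ?_, fun k => ?_, hXc, hXm, fun i j => ?_⟩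
  · exact h.range_eq (fun i => hl.mem_a _) (hl.inj_a.comp neg_injective)
  · have e : (fun i => m i (i + k)) = fun i =>
        (![b (2 - i), c (1 - i), d (2 - i)] : Fin 3 → AffineSubspace ℝ Space) k := by
      funext i
      simp [hm]
    rw [e]
    fin_cases k
    · exact h.range_eq (i := 1) (fun i => hl.mem_b _) (hl.inj_b.comp sub_right_injective)
    · exact h.range_eq (i := 2) (fun i => hl.mem_c _) (hl.inj_c.comp sub_right_injective)
    · exact h.range_eq (i := 3) (fun i => hl.mem_d _) (hl.inj_d.comp sub_right_injective)
  · fin_cases i <;> fin_cases j <;>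
      first
        | exact hb _ (sb _) (by decide) (by decide)
        | exact hc _ (sc _) (by decide) (by decide)
        | exact hd _ (sd _) (by decide) (by decide)

theorem IsAdmissible.isColoredDesarguesType {L : Fin 4 → Set (AffineSubspace ℝ Space)}
    (h : IsAdmissible L) (ht : HasType L 2 1 2 0) : IsColoredDesarguesType L := by
  obtain ⟨σ, a, b, c, d, hl⟩ := ht
  obtain ⟨c', m, X, Y, hd⟩ := hl.exists_isDesarguesLabelling (h.comp_perm σ)
  exact (hd.isColoredDesarguesType (h.comp_perm σ)).of_perm σ

/-! ### Points of a cyclic labelling -/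

/-- In a cyclic labelling, the `n`-th incidence of the three colors other than `k` is on the line
of color `i` with label `n + shift s t u v k i`. -/
def shift (s t u v : Fin 3) : Fin 4 → Fin 4 → Fin 3 :=
  ![![0, 0, u, v], ![0, 0, s, t], ![0, 1, 0, 0], ![0, 0, 0, 0]]

/-- The `n`-th incidence of the three colors other than `k` is on the line of color `i` with label
`m`. -/
abbrev CyclicIncidence (s t u v : Fin 3) (x y : Fin 4 × Fin 3) : Prop :=
  y.1 ≠ x.1 ∧ y.2 = x.2 + shift s t u v x.1 y.1

namespace IsCyclicLabelling

variable {L : Fin 4 → Set (AffineSubspace ℝ Space)} {a b c d : Fin 3 → AffineSubspace ℝ Space}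
  {s t u v : Fin 3}

theorem mem_lines (hl : IsCyclicLabelling L a b c d s t u v) (y : Fin 4 × Fin 3) :
    (![a, b, c, d] : Fin 4 → Fin 3 → AffineSubspace ℝ Space) y.1 y.2 ∈ L y.1 := by
  obtain ⟨i, n⟩ := y
  fin_cases i
  exacts [hl.mem_a n, hl.mem_b n, hl.mem_c n, hl.mem_d n]

theorem lines_injective (hl : IsCyclicLabelling L a b c d s t u v) (h : IsAdmissible L) :
    Function.Injective fun y : Fin 4 × Fin 3 =>
      (![a, b, c, d] : Fin 4 → Fin 3 → AffineSubspace ℝ Space) y.1 y.2 := by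
  rintro ⟨i, n⟩ ⟨j, m⟩ e
  have hij : i = j := by
    by_contra hij
    exact h.disjoint hij (hl.mem_lines (i, n)) (hl.mem_lines (j, m)) e
  subst hij
  refine Prod.ext rfl ?_
  fin_cases i
  exacts [hl.inj_a e, hl.inj_b e, hl.inj_c e, hl.inj_d e]

/-- There are no incidences beyond the labelled ones: a line of the omitted color would give a
colorful incidence, and a second line of another color contradicts `line_unique`. -/
theorem exists_points (hl : IsCyclicLabelling L a b c d s t u v) (h : IsAdmissible L) :
    ∃ p : Fin 4 × Fin 3 → Space, Function.Injective p ∧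
      ∀ x y, p x ∈ (![a, b, c, d] : Fin 4 → Fin 3 → AffineSubspace ℝ Space) y.1 y.2 ↔
        CyclicIncidence s t u v x y := by
  have hex : ∀ x : Fin 4 × Fin 3, ∃ p : Space, ∀ i, i ≠ x.1 →
      p ∈ (![a, b, c, d] : Fin 4 → Fin 3 → AffineSubspace ℝ Space) i
        (x.2 + shift s t u v x.1 i) := by
    rintro ⟨k, n⟩
    fin_cases k
    · obtain ⟨p, h₁, h₂, h₃⟩ := hl.bcd n
      refine ⟨p, fun i hi => ?_⟩
      fin_cases i <;> simp_all [shift]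
    · obtain ⟨p, h₁, h₂, h₃⟩ := hl.acd n
      refine ⟨p, fun i hi => ?_⟩
      fin_cases i <;> simp_all [shift]
    · obtain ⟨p, h₁, h₂, h₃⟩ := hl.abd n
      refine ⟨p, fun i hi => ?_⟩
      fin_cases i <;> simp_all [shift]
    · obtain ⟨p, h₁, h₂, h₃⟩ := hl.abc n
      refine ⟨p, fun i hi => ?_⟩
      fin_cases i <;> simp_all [shift]
  choose p hp using hex
  have hiff : ∀ x y, p x ∈ (![a, b, c, d] : Fin 4 → Fin 3 → AffineSubspace ℝ Space) y.1 y.2 ↔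
      CyclicIncidence s t u v x y := by
    rintro ⟨k, n⟩ ⟨i, m⟩
    constructor
    · intro hmem
      have hik : i ≠ k := by
        rintro rfl
        refine h.not_colorful ⟨p (i, n), fun j _ => ?_⟩
        by_cases hji : j = i
        · subst hji
          exact ⟨_, hl.mem_lines (j, m), hmem⟩
        · exact ⟨_, hl.mem_lines (j, _), hp (i, n) j hji⟩
      refine ⟨hik, ?_⟩
      obtain ⟨j, l, hij, hil, hjl, hjk, hlk⟩ : ∃ j l : Fin 4, i ≠ j ∧ i ≠ l ∧ j ≠ l ∧ j ≠ k ∧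
          l ≠ k := by
        clear hmem
        revert i k
        decide
      have e := h.line_unique hij hil hjl (hl.mem_lines (i, m))
        (hl.mem_lines (i, n + shift s t u v k i)) (hl.mem_lines (j, n + shift s t u v k j))
        (hl.mem_lines (l, n + shift s t u v k l)) hmem (hp (k, n) i hik) (hp (k, n) j hjk)
        (hp (k, n) l hlk)
      exact congrArg Prod.snd (hl.lines_injective h (a₁ := (i, m)) (a₂ := (i, _)) e)
    · rintro ⟨hik, hm⟩
      obtain rfl : m = n + shift s t u v k i := hm
      exact hp (k, n) i hik
  refine ⟨p, ?_, hiff⟩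
  rintro ⟨k, n⟩ ⟨k', n'⟩ e
  have hkk : k = k' := by
    by_contra hkk
    have := hp (k', n') k hkk
    rw [← e] at this
    exact ((hiff (k, n) (k, _)).1 this).1 rfl
  subst hkk
  obtain ⟨i, hi⟩ : ∃ i, i ≠ k := exists_ne k
  have := hp (k, n') i hi
  rw [← e] at this
  have h2 : n' + _ = n + _ := ((hiff (k, n) (i, _)).1 this).2
  exact Prod.ext rfl (add_right_cancel h2).symm

end IsCyclicLabelling

/-! ### Twelve-three configurations -/

theorem isTwelveThree_range {Λ Φ : Fin 4 × Fin 3 → Submodule ℝ HomSpace}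
    (hΛ : Function.Injective Λ) (hΦ : Function.Injective Φ)
    (hrank : ∀ x, Module.finrank ℝ (Φ x) = 1)
    (hle : ∀ x y, Φ x ≤ Λ y ↔ CyclicIncidence 2 1 1 1 x y) : IsTwelveThree (Set.range Λ) := by
  have h12 : ∀ f : Fin 4 × Fin 3 → Submodule ℝ HomSpace, Function.Injective f →
      (Set.range f).ncard = 12 := fun f hf => by
    rw [← Set.image_univ, Set.ncard_image_of_injective _ hf, Set.ncard_univ]
    simp
  have hcount₁ : ∀ x, (Finset.univ.filter fun y => CyclicIncidence 2 1 1 1 x y).card = 3 := by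
    decide
  have hcount₂ : ∀ y, (Finset.univ.filter fun x => CyclicIncidence 2 1 1 1 x y).card = 3 := by
    decide
  refine ⟨h12 Λ hΛ, Set.range Φ, h12 Φ hΦ, ?_, ?_⟩
  · rintro _ ⟨x, rfl⟩
    refine ⟨hrank x, ?_⟩
    have e : {l | l ∈ Set.range Λ ∧ Φ x ≤ l} =
        Λ '' ↑(Finset.univ.filter fun y => CyclicIncidence 2 1 1 1 x y) := by
      ext l
      constructor
      · rintro ⟨⟨y, rfl⟩, hy⟩
        exact ⟨y, by simpa using (hle x y).1 hy, rfl⟩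
      · rintro ⟨y, hy, rfl⟩
        exact ⟨⟨y, rfl⟩, (hle x y).2 (by simpa using hy)⟩
    rw [e, Set.ncard_image_of_injective _ hΛ, Set.ncard_coe_finset, hcount₁]
  · rintro _ ⟨y, rfl⟩
    have e : {p | p ∈ Set.range Φ ∧ p ≤ Λ y} =
        Φ '' ↑(Finset.univ.filter fun x => CyclicIncidence 2 1 1 1 x y) := by
      ext l
      constructor
      · rintro ⟨⟨x, rfl⟩, hx⟩
        exact ⟨x, by simpa using (hle x y).1 hx, rfl⟩
      · rintro ⟨x, hx, rfl⟩
        exact ⟨⟨x, rfl⟩, (hle x y).2 (by simpa using hx)⟩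
    rw [e, Set.ncard_image_of_injective _ hΦ, Set.ncard_coe_finset, hcount₂]

theorem eq_of_projCompletion_eq {l m : AffineSubspace ℝ Space} (hl : IsLine l) (hm : IsLine m)
    (h : projCompletion l = projCompletion m) : l = m := by
  ext x
  rw [← homPoint_mem_iff hl.nonempty, h, homPoint_mem_iff hm.nonempty]

theorem eq_of_homPoint_mem_span {x y : Space}
    (h : homPoint x ∈ Submodule.span ℝ {homPoint y}) : x = y := by
  obtain ⟨r, hr⟩ := Submodule.mem_span_singleton.1 h
  have h2 : r * 1 = 1 := congrArg Prod.snd hr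
  have h1 : r • y = x := congrArg Prod.fst hr
  rw [mul_one] at h2
  rw [← h1, h2, one_smul]

theorem IsCyclicLabelling.isTwelveThree {L : Fin 4 → Set (AffineSubspace ℝ Space)}
    {a b c d : Fin 3 → AffineSubspace ℝ Space} (hl : IsCyclicLabelling L a b c d 2 1 1 1)
    (h : IsAdmissible L) (T : HomSpace ≃ₗ[ℝ] HomSpace) :
    IsTwelveThree (projImage T '' ⋃ i, L i) := by
  obtain ⟨p, hp, hinc⟩ := hl.exists_points h
  set ln := fun y : Fin 4 × Fin 3 =>
    (![a, b, c, d] : Fin 4 → Fin 3 → AffineSubspace ℝ Space) y.1 y.2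
  have hline : ∀ y, IsLine (ln y) := fun y => h.isLine _ _ (hl.mem_lines y)
  have hTinj := Submodule.map_injective_of_injective (f := (T : HomSpace →ₗ[ℝ] HomSpace))
    T.injective
  have hrange : projImage T '' ⋃ i, L i = Set.range fun y => projImage T (ln y) := by
    have : ⋃ i, L i = Set.range ln := by
      ext l
      constructor
      · intro hl'
        obtain ⟨i, hi⟩ := Set.mem_iUnion.1 hl'
        have hr := h.range_eq (fun n => hl.mem_lines (i, n))
          (fun n m e => congrArg Prod.snd (hl.lines_injective h e))
        rw [← hr] at hi
        obtain ⟨n, rfl⟩ := hi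
        exact ⟨(i, n), rfl⟩
      · rintro ⟨y, rfl⟩
        exact Set.mem_iUnion.2 ⟨_, hl.mem_lines y⟩
    rw [this, ← Set.range_comp]
    rfl
  rw [hrange]
  refine isTwelveThree_range
    (Φ := fun x => (Submodule.span ℝ {homPoint (p x)}).map (T : HomSpace →ₗ[ℝ] HomSpace))
    (fun y y' e => hl.lines_injective h (eq_of_projCompletion_eq (hline y) (hline y') (hTinj e)))
    (fun x x' e => hp (eq_of_homPoint_mem_span ?_)) (fun x => ?_) (fun x y => ?_)
  · rw [← hTinj e]
    exact Submodule.mem_span_singleton_self _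
  · rw [LinearEquiv.finrank_map_eq]
    exact finrank_span_singleton (homPoint_ne_zero _)
  · rw [← hinc, ← homPoint_mem_iff (hline y).nonempty]
    unfold projImage
    rw [Submodule.map_le_map_iff_of_injective T.injective, Submodule.span_singleton_le_iff_mem]

/-! ### Reye-type configurations -/

theorem IsLine.exists_homPoint_eq {l : AffineSubspace ℝ Space} (hl : IsLine l) {p q r : Space}
    (hp : p ∈ l) (hq : q ∈ l) (hr : r ∈ l) (hpq : p ≠ q) (hpr : p ≠ r) (hqr : q ≠ r) :
    ∃ x y : ℝ, x ≠ 0 ∧ y ≠ 0 ∧ homPoint r = x • homPoint p + y • homPoint q := by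
  have h := homPoint_mem hr
  rw [hl.projCompletion_eq hp hq hpq] at h
  obtain ⟨x, y, e⟩ := Submodule.mem_span_pair.1 h
  refine ⟨x, y, ?_, ?_, e.symm⟩
  · rintro rfl
    refine hqr (eq_of_homPoint_mem_span ?_).symm
    rw [← e, zero_smul, zero_add]
    exact Submodule.smul_mem _ _ (Submodule.mem_span_singleton_self _)
  · rintro rfl
    refine hpr (eq_of_homPoint_mem_span ?_).symm
    rw [← e, zero_smul, add_zero]
    exact Submodule.smul_mem _ _ (Submodule.mem_span_singleton_self _)

/-- The linear map with the values `O` at the origin and `E i` at the `i`-th point at infinity. -/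
def frameMap (O : HomSpace) (E : Fin 3 → HomSpace) : HomSpace →ₗ[ℝ] HomSpace :=
  (LinearMap.snd ℝ Space ℝ).smulRight O +
    ∑ i, ((LinearMap.proj i).comp (LinearMap.fst ℝ Space ℝ)).smulRight (E i)

theorem frameMap_apply (O : HomSpace) (E : Fin 3 → HomSpace) (x : HomSpace) :
    frameMap O E x = x.2 • O + ∑ i, x.1 i • E i := by
  simp [frameMap]

/-- The incidences of a Reye-type configuration: four independent points `o`, `e i`, and
the points that become `o + e i`, `o + e i + e (i + 1)`, `o + e 0 + e 1 + e 2` after rescaling. -/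
structure IsReyeLabelling (g h k t : Fin 3 → AffineSubspace ℝ Space) (o u : Space)
    (e v w : Fin 3 → Space) : Prop where
  isLine_g : ∀ i, IsLine (g i)
  isLine_h : ∀ i, IsLine (h i)
  isLine_k : ∀ i, IsLine (k i)
  o_g : ∀ i, o ∈ g i
  e_g : ∀ i, e i ∈ g i
  v_g : ∀ i, v i ∈ g i
  v_h : ∀ i, v i ∈ h i
  w_h : ∀ i, w i ∈ h i
  e_h : ∀ i, e (i + 1) ∈ h i
  w_k : ∀ i, w i ∈ k i
  u_k : ∀ i, u ∈ k i
  e_k : ∀ i, e (i + 2) ∈ k i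
  w_t : ∀ i, w i ∈ t i
  v_t : ∀ i, v (i + 2) ∈ t i
  o_ne_e : ∀ i, o ≠ e i
  o_ne_v : ∀ i, o ≠ v i
  u_ne_e : ∀ i, u ≠ e i
  u_ne_w : ∀ i, u ≠ w i
  e_ne_v : ∀ i j, e i ≠ v j
  e_ne_w : ∀ i j, e i ≠ w j
  v_ne_w : ∀ i j, v i ≠ w j
  not_coplanar : ∀ P, IsPlane P → ∃ i, ¬ g i ≤ P
  g_injective : Function.Injective g

namespace IsReyeLabelling

variable {g h k t : Fin 3 → AffineSubspace ℝ Space} {o u : Space} {e v w : Fin 3 → Space}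

/-- The plane of two lines `g` misses the third, so it separates one `e i` from the other points of
the frame. This yields their linear independence in `frameMap_injective`. -/
theorem exists_plane (hr : IsReyeLabelling g h k t o u e v w) (i : Fin 3) :
    ∃ P, IsPlane P ∧ o ∈ P ∧ (∀ j, j ≠ i → e j ∈ P) ∧ e i ∉ P := by
  obtain ⟨P, hP, h₁, h₂⟩ := exists_isPlane_of_lines (hr.isLine_g (i + 1)) (hr.isLine_g (i + 2))
    (hr.g_injective.ne (by simp)) (hr.o_g _) (hr.o_g _)
  have hj : ∀ j, j ≠ i → g j ≤ P := by
    intro j hj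
    obtain rfl | rfl : j = i + 1 ∨ j = i + 2 := by
      clear h₁ h₂
      revert i j
      decide
    exacts [h₁, h₂]
  refine ⟨P, hP, h₁ (hr.o_g _), fun j hji => hj j hji (hr.e_g j), fun hi => ?_⟩
  obtain ⟨j, hjP⟩ := hr.not_coplanar P hP
  by_cases hji : j = i
  · subst hji
    exact hjP ((hr.isLine_g j).le_of_mem (hr.o_ne_e j) (hr.o_g j) (hr.e_g j) (h₁ (hr.o_g _)) hi)
  · exact hjP (hj j hji)

theorem frameMap_injective (hr : IsReyeLabelling g h k t o u e v w) {c : Fin 3 → ℝ}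
    (hc : ∀ i, c i ≠ 0) :
    Function.Injective (frameMap (homPoint o) fun i => c i • homPoint (e i)) := by
  rw [injective_iff_map_eq_zero]
  intro x hx
  rw [frameMap_apply] at hx
  have h0 : ∀ i, x.1 i = 0 := by
    intro i
    by_contra hi
    obtain ⟨P, hP, hoP, hjP, hiP⟩ := hr.exists_plane i
    refine hiP ((homPoint_mem_iff hP.nonempty).1 ?_)
    rw [← Finset.add_sum_erase _ _ (Finset.mem_univ i)] at hx
    have hmem : (x.1 i * c i) • homPoint (e i) ∈ projCompletion P := by
      rw [mul_smul, ← neg_mem_iff]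
      have : -(x.1 i • c i • homPoint (e i)) = x.2 • homPoint o +
          ∑ j ∈ Finset.univ.erase i, x.1 j • c j • homPoint (e j) := by
        rw [neg_eq_iff_add_eq_zero, ← hx]
        abel
      rw [this]
      refine add_mem (Submodule.smul_mem _ _ (homPoint_mem hoP)) (sum_mem fun j hj => ?_)
      exact Submodule.smul_mem _ _ (Submodule.smul_mem _ _
        (homPoint_mem (hjP j (Finset.ne_of_mem_erase hj))))
    rwa [Submodule.smul_mem_iff _ (mul_ne_zero hi (hc i))] at hmem
  simp only [h0, zero_smul, Finset.sum_const_zero, add_zero, smul_eq_zero] at hx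
  exact Prod.ext (funext h0) (hx.resolve_right (homPoint_ne_zero o))

/-- A linear automorphism matching the points of the configuration with vertices of the cube. -/
theorem exists_frame (hr : IsReyeLabelling g h k t o u e v w) :
    ∃ S : HomSpace ≃ₗ[ℝ] HomSpace,
      (∃ x : ℝ, x ≠ 0 ∧ homPoint o = x • S (homPoint 0)) ∧
      (∀ i, ∃ x : ℝ, x ≠ 0 ∧ homPoint (v i) = x • S (homPoint (Pi.single i 1))) ∧
      (∀ i, ∃ x : ℝ, x ≠ 0 ∧
        homPoint (w i) = x • S (homPoint (Pi.single i 1 + Pi.single (i + 1) 1))) ∧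
      ∃ x : ℝ, x ≠ 0 ∧ homPoint u = x • S (homPoint 1) := by
  -- The ratios `β i / α i` rescale the vectors of `e i` so that `v i` becomes the unit point of its
  -- axis.
  choose α β hα hβ hv using fun i => (hr.isLine_g i).exists_homPoint_eq (hr.o_g i) (hr.e_g i)
    (hr.v_g i) (hr.o_ne_e i) (hr.o_ne_v i) (hr.e_ne_v i i)
  have hc : ∀ i, β i / α i ≠ 0 := fun i => div_ne_zero (hβ i) (hα i)
  set E : Fin 3 → HomSpace := fun i => (β i / α i) • homPoint (e i) with hE
  set S := LinearEquiv.ofInjectiveEndo _ (hr.frameMap_injective hc) with hS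
  have hSapp : ∀ x, S x = x.2 • homPoint o + ∑ i, x.1 i • E i := fun x => by
    rw [hS, LinearEquiv.coe_ofInjectiveEndo, frameMap_apply]
  have hSo : S (homPoint 0) = homPoint o := by
    rw [hSapp]
    simp [homPoint]
  have hSe : ∀ i, S (Pi.single i 1, 0) = E i := fun i => by
    rw [hSapp]
    simp [Pi.single_apply]
  have he : ∀ i, ∃ x : ℝ, x ≠ 0 ∧ homPoint (e i) = x • S (Pi.single i 1, 0) := fun i => by
    refine ⟨(β i / α i)⁻¹, inv_ne_zero (hc i), ?_⟩
    rw [hSe, hE, smul_smul, inv_mul_cancel₀ (hc i), one_smul]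
  have hv' : ∀ i, homPoint (v i) = α i • S (homPoint (Pi.single i 1)) := fun i => by
    have : homPoint (Pi.single i 1) = homPoint 0 + (Pi.single i 1, 0) := by
      simp [homPoint]
    rw [this, map_add, hSo, hSe, hE, hv, smul_add, smul_smul, mul_div_cancel₀ _ (hα i)]
  have hw : ∀ i, ∃ x y : ℝ, x ≠ 0 ∧
      homPoint (w i) = S (x • homPoint (Pi.single i 1) + y • (Pi.single (i + 1) 1, 0)) := fun i => by
    obtain ⟨x, y, hx, hy, hxy⟩ := (hr.isLine_h i).exists_homPoint_eq (hr.v_h i) (hr.e_h i)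
      (hr.w_h i) (hr.e_ne_v _ _).symm (hr.v_ne_w _ _) (hr.e_ne_w _ _)
    obtain ⟨z, hz, hez⟩ := he (i + 1)
    refine ⟨x * α i, y * z, mul_ne_zero hx (hα i), ?_⟩
    rw [hxy, hv', hez, map_add, map_smul, map_smul, smul_smul, smul_smul]
  choose γ δ hγ hw' using hw
  have hu : ∀ i, ∃ x y : ℝ, x ≠ 0 ∧ homPoint u = S (x • (γ i • homPoint (Pi.single i 1) +
      δ i • (Pi.single (i + 1) 1, 0)) + y • (Pi.single (i + 2) 1, 0)) := fun i => by
    obtain ⟨x, y, hx, hy, hxy⟩ := (hr.isLine_k i).exists_homPoint_eq (hr.w_k i) (hr.e_k i)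
      (hr.u_k i) (hr.e_ne_w _ _).symm (hr.u_ne_w _).symm (hr.u_ne_e _).symm
    obtain ⟨z, hz, hez⟩ := he (i + 2)
    refine ⟨x, y * z, hx, ?_⟩
    rw [hxy, hw', hez, smul_smul, ← map_smul, ← map_smul, ← map_add]
  choose ε ζ hε hu' using hu
  obtain ⟨U, hU⟩ := S.surjective (homPoint u)
  have hU' : ∀ i, U = ε i • (γ i • homPoint (Pi.single i 1) +
      δ i • (Pi.single (i + 1) 1, 0)) + ζ i • (Pi.single (i + 2) 1, 0) := fun i =>
    S.injective (hU.trans (hu' i))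
  have c2 : ∀ i, U.2 = ε i * γ i := fun i => by
    rw [hU' i]
    simp [homPoint]
  have c0 : ∀ i, U.1 i = ε i * γ i := fun i => by
    rw [hU' i]
    simp [homPoint]
  have c1 : ∀ i, U.1 (i + 1) = ε i * δ i := fun i => by
    rw [hU' i]
    simp [homPoint]
  -- The three lines `k i` meet in the single point `u`. Comparing its coordinates computed along
  -- lines `i` and `i + 1` fixes the positions of all `w i`, and makes all coordinates of `u` equal.
  have hγδ : ∀ i, δ i = γ i := fun i => by
    have := (c1 i).symm.trans ((c0 (i + 1)).trans ((c2 (i + 1)).symm.trans (c2 i)))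
    exact mul_left_cancel₀ (hε i) this
  refine ⟨S, ⟨1, one_ne_zero, by rw [hSo, one_smul]⟩, fun i => ⟨α i, hα i, hv' i⟩,
    fun i => ⟨γ i, hγ i, ?_⟩, ⟨U.2, ?_, ?_⟩⟩
  · rw [hw', hγδ, ← smul_add, map_smul]
    congr 2
    simp [homPoint]
  · rw [c2 0]
    exact mul_ne_zero (hε 0) (hγ 0)
  · rw [← hU, ← map_smul]
    congr 1
    refine Prod.ext (funext fun i => ?_) ?_
    · simp [homPoint, c0 i, c2 i]
    · simp [homPoint]

end IsReyeLabelling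

theorem IsLine.projImage_eq {l : AffineSubspace ℝ Space} (hl : IsLine l)
    (S : HomSpace ≃ₗ[ℝ] HomSpace) {p q p' q' : Space} (hp : p ∈ l) (hq : q ∈ l) (hpq : p ≠ q)
    (h₁ : ∃ x : ℝ, x ≠ 0 ∧ homPoint p = x • S (homPoint p'))
    (h₂ : ∃ x : ℝ, x ≠ 0 ∧ homPoint q = x • S (homPoint q')) :
    projImage S.symm l = projCompletion line[ℝ, p', q'] := by
  obtain ⟨x, hx, ex⟩ := h₁
  obtain ⟨y, hy, ey⟩ := h₂
  have e : projCompletion l =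
      (projCompletion line[ℝ, p', q']).map (S : HomSpace →ₗ[ℝ] HomSpace) := by
    rw [hl.projCompletion_eq hp hq hpq, projCompletion_pair, Submodule.map_span, Set.image_pair,
      Submodule.span_insert, Submodule.span_insert, ex, ey,
      Submodule.span_singleton_smul_eq hx.isUnit, Submodule.span_singleton_smul_eq hy.isUnit]
    rfl
  unfold projImage
  rw [e, ← Submodule.map_comp]
  simp

theorem iUnion_reyeColoring_subset : ⋃ i, reyeColoring i ⊆ cubeLines := by
  refine Set.iUnion_subset fun i => ?_
  fin_cases i <;> (rintro _ (rfl | rfl | rfl)) <;>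
    refine ⟨_, _, ?_, ?_, ?_, rfl⟩ <;>
    simp [ExistsUnique, Fin.forall_fin_succ, Fin.exists_fin_succ]

theorem IsColoredReyeType.of_perm {L : Fin 4 → Set (AffineSubspace ℝ Space)}
    (σ : Equiv.Perm (Fin 4)) (h : IsColoredReyeType fun i => L (σ i)) : IsColoredReyeType L := by
  obtain ⟨T, hT, τ, hτ⟩ := h
  exact ⟨T, by rwa [σ.surjective.iUnion_comp] at hT, τ.trans σ, hτ⟩

/-- The incidences of the colors 1, 2, 3 with indices 1 and 2 become the opposite vertices `000` and
`111` of the cube. The points `e i` go to infinity, `v i` and `w i` to the other vertices; the lines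
of color 0 are the edges joining `v i` to `w i`. -/
theorem IsCyclicLabelling.exists_isReyeLabelling {L : Fin 4 → Set (AffineSubspace ℝ Space)}
    {a b c d : Fin 3 → AffineSubspace ℝ Space} (hl : IsCyclicLabelling L a b c d 2 1 1 1)
    (h : IsAdmissible L) :
    ∃ o u e v w, IsReyeLabelling ![c 2, b 1, d 2] a ![c 0, b 2, d 0] ![b 0, d 1, c 1] o u e v w := by
  obtain ⟨p, hp, hinc⟩ := hl.exists_points h
  set ln := fun y : Fin 4 × Fin 3 =>
    (![a, b, c, d] : Fin 4 → Fin 3 → AffineSubspace ℝ Space) y.1 y.2 with hln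
  have hmem : ∀ x y, CyclicIncidence 2 1 1 1 x y → p x ∈ ln y := fun x y hxy => (hinc x y).2 hxy
  have hline : ∀ y, IsLine (ln y) := fun y => h.isLine _ _ (hl.mem_lines y)
  set yg : Fin 3 → Fin 4 × Fin 3 := ![(2, 2), (1, 1), (3, 2)]
  set yh : Fin 3 → Fin 4 × Fin 3 := ![(0, 0), (0, 1), (0, 2)]
  set yk : Fin 3 → Fin 4 × Fin 3 := ![(2, 0), (1, 2), (3, 0)]
  set yt : Fin 3 → Fin 4 × Fin 3 := ![(1, 0), (3, 1), (2, 1)]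
  have eg : ![c 2, b 1, d 2] = fun i => ln (yg i) := by
    funext i
    fin_cases i <;> rfl
  have eh : a = fun i => ln (yh i) := by
    funext i
    fin_cases i <;> rfl
  have ek : ![c 0, b 2, d 0] = fun i => ln (yk i) := by
    funext i
    fin_cases i <;> rfl
  have et : ![b 0, d 1, c 1] = fun i => ln (yt i) := by
    funext i
    fin_cases i <;> rfl
  set xe : Fin 3 → Fin 4 × Fin 3 := ![(3, 2), (2, 0), (1, 1)]
  set xv : Fin 3 → Fin 4 × Fin 3 := ![(1, 0), (3, 1), (2, 2)]
  set xw : Fin 3 → Fin 4 × Fin 3 := ![(3, 0), (2, 1), (1, 2)]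
  have hg : ∀ i, p (xe i) ∈ ln (yg i) := fun i => hmem _ _ (by revert i; decide)
  have hvg : ∀ i, p (xv i) ∈ ln (yg i) := fun i => hmem _ _ (by revert i; decide)
  have hvh : ∀ i, p (xv i) ∈ ln (yh i) := fun i => hmem _ _ (by revert i; decide)
  have heh : ∀ i, p (xe (i + 1)) ∈ ln (yh i) := fun i => hmem _ _ (by revert i; decide)
  have hev : ∀ i j, p (xe i) ≠ p (xv j) := fun i j => hp.ne (by revert i j; decide)
  refine ⟨p (0, 1), p (0, 2), fun i => p (xe i), fun i => p (xv i), fun i => p (xw i), ?_⟩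
  rw [eg, ek, et]
  nth_rewrite 1 [eh]
  refine ⟨fun i => hline _, fun i => hline _, fun i => hline _,
    fun i => hmem _ _ (by revert i; decide), hg, hvg, hvh,
    fun i => hmem _ _ (by revert i; decide), heh, fun i => hmem _ _ (by revert i; decide),
    fun i => hmem _ _ (by revert i; decide), fun i => hmem _ _ (by revert i; decide),
    fun i => hmem _ _ (by revert i; decide), fun i => hmem _ _ (by revert i; decide),
    fun i => hp.ne (by revert i; decide), fun i => hp.ne (by revert i; decide),
    fun i => hp.ne (by revert i; decide), fun i => hp.ne (by revert i; decide),
    hev, fun i j => hp.ne (by revert i j; decide), fun i j => hp.ne (by revert i j; decide),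
    fun P hP => ?_, (hl.lines_injective h).comp (by decide)⟩
  -- Each line of color 0 joins some `e (i + 1)` to `v i`, so a plane through all `g i` would
  -- contain the whole class.
  by_contra! hc
  obtain ⟨x, hx, hxP⟩ := h.exists_not_le 0 hP
  rw [← h.range_eq hl.mem_a hl.inj_a, eh] at hx
  obtain ⟨i, rfl⟩ := hx
  exact hxP ((hline _).le_of_mem (hev (i + 1) i) (heh i) (hvh i) (hc _ (hg _)) (hc _ (hvg i)))

theorem IsCyclicLabelling.isColoredReyeType {L : Fin 4 → Set (AffineSubspace ℝ Space)}
    {a b c d : Fin 3 → AffineSubspace ℝ Space} (hl : IsCyclicLabelling L a b c d 2 1 1 1)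
    (h : IsAdmissible L) : IsColoredReyeType L := by
  obtain ⟨o, u, e, v, w, hr⟩ := hl.exists_isReyeLabelling h
  obtain ⟨S, ho, hv, hw, hu⟩ := hr.exists_frame
  have h000 : (0 : Space) = ![0, 0, 0] := by ext i; fin_cases i <;> rfl
  have h111 : (1 : Space) = ![1, 1, 1] := by ext i; fin_cases i <;> rfl
  have h100 : (Pi.single 0 1 : Space) = ![1, 0, 0] := by ext i; fin_cases i <;> simp
  have h010 : (Pi.single 1 1 : Space) = ![0, 1, 0] := by ext i; fin_cases i <;> simp
  have h001 : (Pi.single 2 1 : Space) = ![0, 0, 1] := by ext i; fin_cases i <;> simp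
  have hv0 := hv 0
  have hv1 := hv 1
  have hv2 := hv 2
  have hw0 := hw 0
  have hw1 := hw 1
  have hw2 := hw 2
  rw [show (0 : Fin 3) + 1 = 1 from rfl] at hw0
  rw [show (1 : Fin 3) + 1 = 2 from rfl] at hw1
  rw [show (2 : Fin 3) + 1 = 0 from rfl] at hw2
  rw [h100, h010] at hw0
  rw [h010, h001] at hw1
  rw [h001, h100] at hw2
  rw [h100] at hv0
  rw [h010] at hv1
  rw [h001] at hv2
  rw [h000] at ho
  rw [h111] at hu
  norm_num at hw0 hw1 hw2
  have ha : ∀ n, IsLine (a n) := fun n => h.isLine 0 _ (hl.mem_a n)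
  have hb : ∀ n, IsLine (b n) := fun n => h.isLine 1 _ (hl.mem_b n)
  have hc : ∀ n, IsLine (c n) := fun n => h.isLine 2 _ (hl.mem_c n)
  have hd : ∀ n, IsLine (d n) := fun n => h.isLine 3 _ (hl.mem_d n)
  have L0 : L 0 = {a 2, a 0, a 1} := by
    rw [← h.range_eq hl.mem_a hl.inj_a]
    ext x
    simp only [Set.mem_range, Fin.exists_fin_succ, Set.mem_insert_iff, Set.mem_singleton_iff]
    simp [eq_comm]
    tauto
  have L1 : L 1 = {b 1, b 2, b 0} := by
    rw [← h.range_eq hl.mem_b hl.inj_b]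
    ext x
    simp [Fin.exists_fin_succ, eq_comm]
    tauto
  have L2 : L 2 = {c 0, c 2, c 1} := by
    rw [← h.range_eq hl.mem_c hl.inj_c]
    ext x
    simp [Fin.exists_fin_succ, eq_comm]
    tauto
  have L3 : L 3 = {d 0, d 2, d 1} := by
    rw [← h.range_eq hl.mem_d hl.inj_d]
    ext x
    simp [Fin.exists_fin_succ, eq_comm]
    tauto
  have key : ∀ i, projImage S.symm '' L i = projCompletion '' reyeColoring i := by
    intro i
    fin_cases i
    · change projImage S.symm '' L 0 = projCompletion '' {_, _, _}
      simp only [L0, Set.image_insert_eq, Set.image_singleton]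
      rw [(ha 2).projImage_eq S (hr.v_h 2) (hr.w_h 2) (hr.v_ne_w _ _) hv2 hw2,
        (ha 0).projImage_eq S (hr.v_h 0) (hr.w_h 0) (hr.v_ne_w _ _) hv0 hw0,
        (ha 1).projImage_eq S (hr.v_h 1) (hr.w_h 1) (hr.v_ne_w _ _) hv1 hw1]
    · change projImage S.symm '' L 1 = projCompletion '' {_, _, _}
      simp only [L1, Set.image_insert_eq, Set.image_singleton]
      rw [(hb 1).projImage_eq S (hr.o_g 1) (hr.v_g 1) (hr.o_ne_v _) ho hv1,
        (hb 2).projImage_eq S (hr.w_k 1) (hr.u_k 1) (hr.u_ne_w _).symm hw1 hu,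
        (hb 0).projImage_eq S (hr.w_t 0) (hr.v_t 0) (hr.v_ne_w _ _).symm hw0 hv2]
    · change projImage S.symm '' L 2 = projCompletion '' {_, _, _}
      simp only [L2, Set.image_insert_eq, Set.image_singleton]
      rw [(hc 0).projImage_eq S (hr.w_k 0) (hr.u_k 0) (hr.u_ne_w _).symm hw0 hu,
        (hc 2).projImage_eq S (hr.o_g 0) (hr.v_g 0) (hr.o_ne_v _) ho hv0,
        (hc 1).projImage_eq S (hr.v_t 2) (hr.w_t 2) (hr.v_ne_w _ _) hv1 hw2]
    · change projImage S.symm '' L 3 = projCompletion '' {_, _, _}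
      simp only [L3, Set.image_insert_eq, Set.image_singleton]
      rw [(hd 0).projImage_eq S (hr.w_k 2) (hr.u_k 2) (hr.u_ne_w _).symm hw2 hu,
        (hd 2).projImage_eq S (hr.o_g 2) (hr.v_g 2) (hr.o_ne_v _) ho hv2,
        (hd 1).projImage_eq S (hr.w_t 1) (hr.v_t 1) (hr.v_ne_w _ _).symm hw1 hv0]
  have hunion : projImage S.symm '' ⋃ i, L i = projCompletion '' ⋃ i, reyeColoring i := by
    rw [Set.image_iUnion, Set.image_iUnion]
    exact Set.iUnion_congr key
  -- The `(12_3)` property is proved for the image of `L`, where it follows from the labels, and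
  -- carried over to the cube lines by `hunion`.
  exact ⟨S.symm, ⟨_, iUnion_reyeColoring_subset, hunion ▸ hl.isTwelveThree h S.symm, hunion⟩,
    Equiv.refl _, key⟩

theorem theorem6 (L : Fin 4 → Set (AffineSubspace ℝ Space))
    (hline : ∀ i, ∀ l ∈ L i, IsLine l)
    (hcons : IsConsistent 3 L)
    (hcolorful : ¬ HasColorfulIncidence L)
    (hcard : ∀ i, (L i).ncard = 3)
    (hplanar : ¬ ∃ P : AffineSubspace ℝ Space, IsPlane P ∧ ∀ i, ∀ l ∈ L i, l ≤ P) :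
    IsColoredDesarguesType L ∨ IsColoredReyeType L := by
  have h : IsAdmissible L := ⟨hline, hcons, hcolorful, hcard, hplanar⟩
  rcases h.hasType with ht | ht | ⟨σ, a, b, c, d, hl⟩
  · exact absurd ht h.not_hasType
  · exact Or.inl (h.isColoredDesarguesType ht)
  · exact Or.inr ((hl.isColoredReyeType (h.comp_perm σ)).of_perm σ)
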